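/- **Model.** Let $\rho,\mu>0$, $0<\varphi<1$, $c_1>1$, $0\le U\le d$, $d>0$, $e_0\ge 0$. A cluster consists of $n\ge 3f+1$ nodes, a set $F$ of at most $f$ of which is faulty (Byzantine). Each correct node $v$ has a hardware clock of rate $h_v(t)\in[1,1+\rho]$ (locally integrable) and a mode $\gamma_v(t)\in\{0,1\}$ (measurable, otherwise arbitrary; $1$ is fast, $0$ is slow), and its logical clock is $$L_v(t)=\int_0^t(1+\varphi\,\delta_v(\tau))(1+\mu\,\gamma_v(\tau))\,h_v(\tau)\,d\tau .$$ Put $\vartheta_g=(1+\rho)(1+\mu)$, $\zeta_{\max}=(1+\varphi)(1+\mu)$, $\gamma=(1+\mu)(\vartheta_g-1)$, $$\alpha_g=\frac{2\vartheta_g^2+5\vartheta_g-5}{2(\vartheta_g+1)(1-\gamma)}+\frac{\gamma}{1-\gamma}(1+c_1),\qquad \beta_g=\frac{\gamma}{1-\gamma}d+\frac{1}{1-\gamma}\bigl((3\vartheta_g-1)+\gamma c_1\bigr)U .$$ Rounds are numbered $r=0,1,2,\dots$; let $e(0)=e_0$, $e(r+1)=\alpha_g e(r)+\beta_g$, and $$\tau_1(r)=\zeta_{\max}\vartheta_g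 e(r),\quad \tau_2(r)=\zeta_{\max}\vartheta_g(e(r)+d),\quad \tau_3(r)=c_1\zeta_{\max}\vartheta_g(e(r)+U).$$ In an execution of the cluster algorithm, each correct node $v$ starts round $0$ at time $t_v(0)=0$. In round $r$, started at time $t_v(r)$, it broadcasts a pulse at a time $p_v(r)$ when its logical clock has advanced by $\tau_1(r)$, ends phase 2 when its logical clock has advanced by $\tau_1(r)+\tau_2(r)$, and ends the round at time $t_v(r+1)$ when its logical clock has advanced by $\tau_1(r)+\tau_2(r)+\tau_3(r)$. A pulse sent by a correct node at time $p$ reaches each correct node of the cluster (including the sender) within $[p+d-U,p+d]$; reception times of pulses of faulty nodes are arbitrary. If $t_{wv}$ is the time when $v$ receives the round $r$ pulse of $w$, then $v$ sets $\Delta_v(r)=\frac12(S^{f+1}+S^{n-f})$, where $S^i$ is the $i$-th smallest element of the multiset of the values $L_v(t_{wv})-L_v(t_{vv})$ over all $w$ in the cluster. It uses $\delta_v=1$ in phases 1 and 2 and $\delta_v=1-(1+\frac1\varphi)\frac{\Delta_v(r)}{\tau_3(r)+\Delta_v(r)}$ in phase 3. The execution is *proper* if in every round $r$, for all correct $v,w$: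 $t_v(r)\le p_w(r)<t_v(r+1)$; $v$ receives the round $r$ pulse of $w$ before its logical time $L_v(t_v(r))+\tau_1(r)+\tau_2(r)$; and $|\Delta_v(r)|\le\varphi\,\tau_3(r)$. The cluster is *unanimously fast (slow) in round $r$* if $\gamma_v(t)=1$ (resp. $0$) for every correct $v$ and all $t\in[t_v(r),t_v(r+1)]$. The cluster clock is $L_C(t)=\frac12\bigl(\max_{v\notin F}L_v(t)+\min_{v\notin F}L_v(t)\bigr)$. **Lemma.** For every $c_2\ge 32$ there are $k\in\mathbb N$ and $a,b,\rho_0>0$ such that for every $0<\rho<\rho_0$ there is $c_1>1$ with $a/\rho\le c_1\le b/\rho$ for which the following holds with $\mu=c_2\rho$. For every $\varphi$ with $1/c_1\le\varphi<1$ (in particular $\varphi=1/c_1$) and all $0\le U\le d$, $d>0$, $e_0\ge0$, the limit $e_g^\infty=\lim_{r\to\infty}e(r)$ exists, and for all $n\ge 3f+1$, every cluster $C$ of $n$ nodes with at most $f$ faulty ones, every proper execution, and every round $r\ge k$ with $e(r-k)\le 2e_g^\infty$: 1. If $C$ is unanimously fast in rounds $r-k,\dots,r$, then for all correct $v\in C$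 $$(1+\varphi)\Bigl(1+\tfrac78\mu\Bigr)\le\frac{L_v(t_v(r+1))-L_v(t_v(r))}{t_v(r+1)-t_v(r)} .$$ 2. If $C$ is unanimously slow in rounds $r-k,\dots,r$, then for all correct $v\in C$ $$(1+\varphi)\Bigl(1-\tfrac18\mu\Bigr)\le\frac{L_v(t_v(r+1))-L_v(t_v(r))}{t_v(r+1)-t_v(r)}\le(1+\varphi)\Bigl(1+\tfrac18\mu\Bigr) .$$ If additionally $C$ is unanimously fast (resp. slow) in round $r+1$, then, for all correct $v\in C$, the inequality of 1 (resp. the inequalities of 2) also holds with $L_C(t_v(r+1))-L_C(t_v(r))$ in place of $L_v(t_v(r+1))-L_v(t_v(r))$. -/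

import Mathlib

open Filter Topology MeasureTheory

noncomputable section

/-- Numerical parameters of the cluster synchronization algorithm: hardware drift `ρ`, speed-up `μ`
of the fast mode, amortization parameter `φ`, stretch factor `c₁` of phase 3, maximal message
delay `d`, delay uncertainty `U`, and error bound `e₀` for the first round. Rounds are numbered
`0, 1, 2, …`. -/
structure SyncParams where
  ρ : ℝ
  μ : ℝ
  φ : ℝ
  c₁ : ℝ
  d : ℝ
  U : ℝ
  e₀ : ℝ

namespace SyncParams

variable (P : SyncParams)

/-- `ϑ_g = (1 + ρ)(1 + μ)`. -/
def thetaG : ℝ := (1 + P.ρ) * (1 + P.μ)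

/-- `ζ_max = (1 + φ)(1 + μ)`. -/
def zetaMax : ℝ := (1 + P.φ) * (1 + P.μ)

/-- The coefficient `γ` of the error recursion when all nominal rates lie in `[ζ, ζ ϑ]`. -/
def coefGamma (ζ ϑ : ℝ) : ℝ := P.zetaMax / ζ * (P.thetaG / ϑ) * (ϑ - 1)

/-- The coefficient `α` of the error recursion when all nominal rates lie in `[ζ, ζ ϑ]`. -/
def coefAlpha (ζ ϑ : ℝ) : ℝ :=
  (2 * ϑ ^ 2 + 5 * ϑ - 5) / (2 * (ϑ + 1) * (1 - P.coefGamma ζ ϑ))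
    + P.coefGamma ζ ϑ / (1 - P.coefGamma ζ ϑ) * (1 + P.c₁)

/-- The coefficient `β` of the error recursion when all nominal rates lie in `[ζ, ζ ϑ]`. -/
def coefBeta (ζ ϑ : ℝ) : ℝ :=
  P.coefGamma ζ ϑ / (1 - P.coefGamma ζ ϑ) * P.d
    + 1 / (1 - P.coefGamma ζ ϑ) * ((3 * ϑ - 1) + P.coefGamma ζ ϑ * P.c₁) * P.U

/-- The error bounds `e(r)` of a general execution: there every nominal rate lies in
`[ζ, ζ ϑ]` with `ζ = 1 + φ` and `ϑ = ϑ_g`. -/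
def err : ℕ → ℝ
  | 0 => P.e₀
  | r + 1 => P.coefAlpha (1 + P.φ) P.thetaG * err r + P.coefBeta (1 + P.φ) P.thetaG

/-- Logical duration of phase 1 of round `r`. -/
def tau1 (r : ℕ) : ℝ := P.zetaMax * P.thetaG * P.err r

/-- Logical duration of phase 2 of round `r`. -/
def tau2 (r : ℕ) : ℝ := P.zetaMax * P.thetaG * (P.err r + P.d)

/-- Logical duration of phase 3 of round `r`. -/
def tau3 (r : ℕ) : ℝ := P.c₁ * P.zetaMax * P.thetaG * (P.err r + P.U)

end SyncParams

/-- For the multiset `S` of the values `g w`, the midpoint `(S^{f+1} + S^{n-f}) / 2`, where `S^i` is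
the `i`-th element in ascending order (list positions are counted from `0`). -/
def trimmedMidpoint {n : ℕ} (f : ℕ) (g : Fin n → ℝ) : ℝ :=
  let S : List ℝ := (Finset.univ.val.map g).sort (· ≤ ·)
  (S.getD f 0 + S.getD (n - f - 1) 0) / 2

/-- The data of an execution on a cluster with node set `Fin n`. For faulty nodes the values are
arbitrary. -/
structure ClusterTrace (n : ℕ) where
  /-- hardware clock rates `h_v` -/
  h : Fin n → ℝ → ℝ
  /-- amortization control `δ_v` -/
  δ : Fin n → ℝ → ℝ
  /-- mode `γ_v`: `1` is fast, `0` is slow -/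
  γ : Fin n → ℝ → ℝ
  /-- `t v r` is the time at which `v` begins round `r` -/
  t : Fin n → ℕ → ℝ
  /-- `p v r` is the time at which `v` sends its pulse of round `r` (end of phase 1) -/
  p : Fin n → ℕ → ℝ
  /-- `s v r` is the time at which phase 2 of round `r` ends at `v` -/
  s : Fin n → ℕ → ℝ
  /-- `recv w v r` is the time at which `v` receives the round `r` pulse of `w` -/
  recv : Fin n → Fin n → ℕ → ℝ

namespace ClusterTrace

variable {n : ℕ} (X : ClusterTrace n) (P : SyncParams) (f : ℕ) (F : Finset (Fin n))

/-- The logical clock `L_v`. -/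
def L (v : Fin n) (x : ℝ) : ℝ :=
  ∫ y in (0 : ℝ)..x, (1 + P.φ * X.δ v y) * (1 + P.μ * X.γ v y) * X.h v y

/-- The correction `Δ_v(r)` computed by `v` at the end of phase 2 of round `r`. -/
def corr (v : Fin n) (r : ℕ) : ℝ :=
  trimmedMidpoint f fun w => X.L P v (X.recv w v r) - X.L P v (X.recv v v r)

/-- `X` is an execution of the cluster synchronization algorithm with parameters `P`, where `F` is
the set of (Byzantine) faulty nodes. The modes `γ_v` are arbitrary. -/
structure IsExecution : Prop where
  hardware_locallyIntegrable : ∀ v ∉ F, LocallyIntegrable (X.h v)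
  hardware_bounds : ∀ v ∉ F, ∀ x, 1 ≤ X.h v x ∧ X.h v x ≤ 1 + P.ρ
  mode_measurable : ∀ v ∉ F, Measurable (X.γ v)
  mode_values : ∀ v ∉ F, ∀ x, X.γ v x = 0 ∨ X.γ v x = 1
  start : ∀ v ∉ F, X.t v 0 = 0
  start_le_pulse : ∀ v ∉ F, ∀ r, X.t v r ≤ X.p v r
  pulse_le_phase : ∀ v ∉ F, ∀ r, X.p v r ≤ X.s v r
  phase_le_next : ∀ v ∉ F, ∀ r, X.s v r ≤ X.t v (r + 1)
  pulse_clock : ∀ v ∉ F, ∀ r, X.L P v (X.p v r) = X.L P v (X.t v r) + P.tau1 r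
  phase_clock : ∀ v ∉ F, ∀ r, X.L P v (X.s v r) = X.L P v (X.t v r) + P.tau1 r + P.tau2 r
  next_clock : ∀ v ∉ F, ∀ r,
    X.L P v (X.t v (r + 1)) = X.L P v (X.t v r) + P.tau1 r + P.tau2 r + P.tau3 r
  /-- Pulses between correct nodes (also from a node to itself) take between `d - U` and `d`. -/
  delay : ∀ v ∉ F, ∀ w ∉ F, ∀ r,
    X.p w r + P.d - P.U ≤ X.recv w v r ∧ X.recv w v r ≤ X.p w r + P.d
  control_phase12 : ∀ v ∉ F, ∀ r, ∀ x ∈ Set.Ico (X.t v r) (X.s v r), X.δ v x = 1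
  control_phase3 : ∀ v ∉ F, ∀ r, ∀ x ∈ Set.Ico (X.s v r) (X.t v (r + 1)),
    X.δ v x = 1 - (1 + 1 / P.φ) * (X.corr P f v r / (P.tau3 r + X.corr P f v r))

/-- Round `r` is properly executed. -/
structure ProperRound (r : ℕ) : Prop where
  in_round : ∀ v ∉ F, ∀ w ∉ F, X.t v r ≤ X.p w r ∧ X.p w r < X.t v (r + 1)
  received : ∀ v ∉ F, ∀ w ∉ F,
    X.L P v (X.recv w v r) < X.L P v (X.t v r) + P.tau1 r + P.tau2 r
  corr_le : ∀ v ∉ F, |X.corr P f v r| ≤ P.φ * P.tau3 r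

/-- The cluster is unanimously fast in round `r`. -/
def FastRound (r : ℕ) : Prop :=
  ∀ v ∉ F, ∀ x ∈ Set.Icc (X.t v r) (X.t v (r + 1)), X.γ v x = 1

/-- The cluster is unanimously slow in round `r`. -/
def SlowRound (r : ℕ) : Prop :=
  ∀ v ∉ F, ∀ x ∈ Set.Icc (X.t v r) (X.t v (r + 1)), X.γ v x = 0

/-- The cluster clock: the mean of the largest and the smallest logical clock of a correct node. -/
def clusterClock (x : ℝ) : ℝ :=
  ((⨆ v : {v : Fin n // v ∉ F}, X.L P v x) + (⨅ v : {v : Fin n // v ∉ F}, X.L P v x)) / 2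

/-- The average rate of a clock `Λ` over round `r` of node `v`. -/
def avgRate (Λ : ℝ → ℝ) (v : Fin n) (r : ℕ) : ℝ :=
  (Λ (X.t v (r + 1)) - Λ (X.t v r)) / (X.t v (r + 1) - X.t v r)

end ClusterTrace

end

/-! In a general round the rates of correct clocks may differ by a relative amount of about ρ + μ,
and `gain` ≈ ρ + μ measures this. The stretch factor is tuned to gain·c₁ ≈ 1/2, which makes α =
999/1000. Hence e(r) converges geometrically to `errLim` = 1000β, a quantity that dominates U and
gain·d, and near the limit a round lasts about errLim/(2·gain). In a unanimous round all correct
clocks share one nominal rate ζ up to the factor 1 + ρ, and ρ ≤ gain/33 because c₂ ≥ 32.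
Synchronization is then much tighter than e(r) suggests.

Properness alone bounds the pulse skew by 3·errLim, since each pulse arrives before the receiver
ends phase 2 (`pulse_skew_le`, `skew_le`). In unanimous rounds the trimmed midpoint halves the skew;
delay uncertainty and ρ times the round length add at most 17/1000·errLim
(`exists_trimmedMidpoint_mem`, `pulse_skew_step`, `skew_step_le`). After 12 such rounds the skew,
and with it the size of a correction in units of ζ, is a few percent of errLim.

The logical length of a round is prescribed, say ζT, and its real length differs from T only by
correction and drift, about 0.05·errLim in total. This is less than μ/8 times the round length,
about 0.06·errLim (`deviation_le`). For the cluster clock, the advance of another clock w over a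
round of v is compared with w's own round. The round boundaries of v and w are close, and between
them w runs almost nominally (`advance_other_round`). The later boundary may fall into w's next
round, which is why round r + 1 must be unanimous too. -/

open Filter Topology MeasureTheory

noncomputable section

/-! ### Order statistics and the trimmed midpoint -/

namespace List

/-- If the entry at position i exceeded c, so would all later ones, leaving at most i entries that
are ≤ c. -/
theorem getElem_le_of_lt_countP {S : List ℝ} (hS : S.Pairwise (· ≤ ·)) {i : ℕ} (hi : i < S.length)
    {c : ℝ} (h : i < S.countP (· ≤ c)) : S[i] ≤ c := by
  by_contra! hc
  have hd : (S.drop i).countP (· ≤ c) = 0 := by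
    rw [List.countP_eq_zero]
    intro x hx
    obtain ⟨j, hj, rfl⟩ := List.mem_iff_getElem.1 hx
    rw [List.getElem_drop]
    have : S[i] ≤ S[i + j]'(by simp at hj; omega) := by
      rcases Nat.eq_zero_or_pos j with rfl | hj0
      · simp
      · exact List.pairwise_iff_getElem.1 hS _ _ _ _ (by omega)
    simpa using hc.trans_le this
  have h1 := List.countP_append (p := fun x => decide (x ≤ c)) (l₁ := S.take i) (l₂ := S.drop i)
  rw [List.take_append_drop, hd] at h1
  have h2 := List.countP_le_length (p := fun x => decide (x ≤ c)) (l := S.take i)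
  have h3 := List.length_take_le i S
  omega

theorem le_getElem_of_countP_le {S : List ℝ} (hS : S.Pairwise (· ≤ ·)) {i : ℕ} (hi : i < S.length)
    {c : ℝ} (h : S.countP (· < c) ≤ i) : c ≤ S[i] := by
  by_contra! hc
  have hd : (S.take (i + 1)).countP (· < c) = (S.take (i + 1)).length := by
    rw [List.countP_eq_length]
    intro x hx
    obtain ⟨j, hj, rfl⟩ := List.mem_iff_getElem.1 hx
    rw [List.getElem_take]
    simp only [List.length_take] at hj
    have : S[j]'(by omega) ≤ S[i] := by
      rcases Nat.eq_or_lt_of_le (show j ≤ i by omega) with rfl | hj0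
      · simp
      · exact List.pairwise_iff_getElem.1 hS _ _ _ _ hj0
    simpa using this.trans_lt hc
  have h1 := List.countP_append (p := fun x => decide (x < c)) (l₁ := S.take (i + 1))
    (l₂ := S.drop (i + 1))
  rw [List.take_append_drop, hd, List.length_take] at h1
  omega

end List

/-- The values of `g` in ascending order. -/
def sortedValues {n : ℕ} (g : Fin n → ℝ) : List ℝ :=
  (Finset.univ.val.map g).sort (· ≤ ·)

theorem pairwise_sortedValues {n : ℕ} (g : Fin n → ℝ) : (sortedValues g).Pairwise (· ≤ ·) :=
  Multiset.pairwise_sort _ _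

theorem length_sortedValues {n : ℕ} (g : Fin n → ℝ) : (sortedValues g).length = n := by
  simp [sortedValues]

theorem countP_sortedValues {n : ℕ} (g : Fin n → ℝ) (p : ℝ → Prop) [DecidablePred p] :
    (sortedValues g).countP (fun x => decide (p x)) = (Finset.univ.filter fun w => p (g w)).card := by
  have h := Multiset.coe_countP p (sortedValues g)
  rw [← h, sortedValues, Multiset.sort_eq, Multiset.countP_map]
  rfl

theorem sortedValues_getD_le {n : ℕ} {g : Fin n → ℝ} {i : ℕ} {c : ℝ} (A : Finset (Fin n))
    (hA : i < A.card) (h : ∀ w ∈ A, g w ≤ c) : (sortedValues g).getD i 0 ≤ c := by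
  have hi : i < (sortedValues g).length := by
    rw [length_sortedValues]; exact hA.trans_le ((Finset.card_le_univ A).trans (by simp))
  rw [List.getD_eq_getElem _ _ hi]
  refine List.getElem_le_of_lt_countP (pairwise_sortedValues g) hi ?_
  rw [countP_sortedValues g (· ≤ c)]
  exact hA.trans_le (Finset.card_le_card fun w hw => by simpa using h w hw)

theorem le_sortedValues_getD {n : ℕ} {g : Fin n → ℝ} {i : ℕ} (hi : i < n) {c : ℝ}
    (A : Finset (Fin n)) (hA : A.card ≤ i) (h : ∀ w ∉ A, c ≤ g w) :
    c ≤ (sortedValues g).getD i 0 := by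
  have hi' : i < (sortedValues g).length := by rwa [length_sortedValues]
  rw [List.getD_eq_getElem _ _ hi']
  refine List.le_getElem_of_countP_le (pairwise_sortedValues g) hi' ?_
  rw [countP_sortedValues g (· < c)]
  refine (Finset.card_le_card fun w hw => ?_).trans hA
  by_contra hwA
  have := h w hwA
  simp only [Finset.mem_filter, Finset.mem_univ, true_and] at hw
  linarith

/-- A family of reals has an `(f + 1)`-st smallest value. -/
theorem exists_order_statistic {ι : Type*} [DecidableEq ι] (G : Finset ι) (q : ι → ℝ) {f : ℕ}
    (hG : f < G.card) :
    ∃ w₀ ∈ G, f < (G.filter fun w => q w ≤ q w₀).card ∧ (G.filter fun w => q w < q w₀).card ≤ f := by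
  have hne : G.Nonempty := Finset.card_pos.1 (by omega)
  obtain ⟨wM, hwM, hM⟩ := Finset.exists_max_image G q hne
  have hS : (G.filter fun w₀ => f < (G.filter fun w => q w ≤ q w₀).card).Nonempty :=
    ⟨wM, by rw [Finset.mem_filter, Finset.filter_true_of_mem hM]; exact ⟨hwM, hG⟩⟩
  obtain ⟨w₀, hw₀, hmin⟩ := Finset.exists_min_image _ q hS
  rw [Finset.mem_filter] at hw₀
  refine ⟨w₀, hw₀.1, hw₀.2, ?_⟩
  by_contra! hlt
  obtain ⟨w₁, hw₁, hmax⟩ := Finset.exists_max_image (G.filter fun w => q w < q w₀) q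
    (Finset.card_pos.1 (by omega))
  rw [Finset.mem_filter] at hw₁
  have := hmin w₁ (by
    rw [Finset.mem_filter]
    refine ⟨hw₁.1, hlt.trans_le (Finset.card_le_card fun w hw => ?_)⟩
    rw [Finset.mem_filter]
    exact ⟨(Finset.mem_filter.1 hw).1, hmax w hw⟩)
  linarith [hw₁.2]

/-- The approximate agreement property of the trimmed midpoint: all nodes that see the values `q w`
of the correct nodes up to an error in `[e₁, e₂]` compute midpoints in an interval of half the
width, up to the same error. -/
theorem exists_trimmedMidpoint_mem {n f : ℕ} (F : Finset (Fin n)) (hn : 3 * f + 1 ≤ n)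
    (hF : F.card ≤ f) (q : Fin n → ℝ) {a b : ℝ} (hq : ∀ w ∉ F, a ≤ q w ∧ q w ≤ b) :
    ∃ m, a ≤ m ∧ m ≤ b ∧ ∀ (g : Fin n → ℝ) (e₁ e₂ : ℝ),
      (∀ w ∉ F, q w + e₁ ≤ g w ∧ g w ≤ q w + e₂) →
      (a + m) / 2 + e₁ ≤ trimmedMidpoint f g ∧ trimmedMidpoint f g ≤ (m + b) / 2 + e₂ := by
  have hc : Fᶜ.card = n - F.card := by rw [Finset.card_compl, Fintype.card_fin]
  obtain ⟨w₀, hw₀, h1, h2⟩ := exists_order_statistic Fᶜ q (f := f) (by omega)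
  refine ⟨q w₀, (hq w₀ (by simpa using hw₀)).1, (hq w₀ (by simpa using hw₀)).2, ?_⟩
  intro g e₁ e₂ hg
  have l1 : a + e₁ ≤ (sortedValues g).getD f 0 :=
    le_sortedValues_getD (by omega) F hF fun w hw => by linarith [(hg w hw).1, (hq w hw).1]
  have l2 : (sortedValues g).getD (n - f - 1) 0 ≤ b + e₂ :=
    sortedValues_getD_le Fᶜ (by omega) fun w hw => by
      rw [Finset.mem_compl] at hw
      linarith [(hg w hw).2, (hq w hw).2]
  have l3 : (sortedValues g).getD f 0 ≤ q w₀ + e₂ :=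
    sortedValues_getD_le _ h1 fun w hw => by
      rw [Finset.mem_filter, Finset.mem_compl] at hw
      linarith [(hg w hw.1).2]
  -- Position n - f - 1 is preceded by at least 2f entries, while at most f faulty values and f
  -- correct ones can lie below this bound.
  have l4 : q w₀ + e₁ ≤ (sortedValues g).getD (n - f - 1) 0 := by
    refine le_sortedValues_getD (by omega) (F ∪ Fᶜ.filter fun w => q w < q w₀)
      ((Finset.card_union_le _ _).trans (by omega)) fun w hw => ?_
    simp only [Finset.mem_union, Finset.mem_filter, Finset.mem_compl, not_or, not_and, not_lt] at hw
    linarith [(hg w hw.1).1, hw.2 hw.1]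
  have : trimmedMidpoint f g
      = ((sortedValues g).getD f 0 + (sortedValues g).getD (n - f - 1) 0) / 2 := rfl
  constructor <;> linarith

/-! ### Clocks and phases of a proper execution -/

namespace SyncParams

/-- The basic sign conditions on the parameters. -/
structure Valid (P : SyncParams) : Prop where
  rho_pos : 0 < P.ρ
  mu_nonneg : 0 ≤ P.μ
  phi_pos : 0 < P.φ
  phi_lt_one : P.φ < 1
  one_lt_c₁ : 1 < P.c₁
  d_pos : 0 < P.d
  U_nonneg : 0 ≤ P.U
  U_le_d : P.U ≤ P.d
  err_nonneg : ∀ r, 0 ≤ P.err r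

namespace Valid

variable {P : SyncParams} (hP : P.Valid)
include hP

theorem one_le_thetaG : 1 ≤ P.thetaG := by
  unfold thetaG; nlinarith [hP.rho_pos, hP.mu_nonneg]

theorem zetaMax_pos : 0 < P.zetaMax := by
  unfold zetaMax
  have := hP.phi_pos; have := hP.mu_nonneg; positivity

theorem tau1_nonneg (r : ℕ) : 0 ≤ P.tau1 r :=
  mul_nonneg (mul_nonneg hP.zetaMax_pos.le (by linarith [hP.one_le_thetaG])) (hP.err_nonneg r)

theorem tau2_pos (r : ℕ) : 0 < P.tau2 r :=
  mul_pos (mul_pos hP.zetaMax_pos (by linarith [hP.one_le_thetaG]))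
    (by linarith [hP.err_nonneg r, hP.d_pos])

theorem tau3_nonneg (r : ℕ) : 0 ≤ P.tau3 r :=
  mul_nonneg (mul_nonneg (mul_nonneg (by linarith [hP.one_lt_c₁]) hP.zetaMax_pos.le)
    (by linarith [hP.one_le_thetaG])) (by linarith [hP.err_nonneg r, hP.U_nonneg])

end Valid
end SyncParams

namespace ClusterTrace

variable {n : ℕ}

/-- The rate of the logical clock `L_v`. -/
def rate (X : ClusterTrace n) (P : SyncParams) (v : Fin n) (y : ℝ) : ℝ :=
  (1 + P.φ * X.δ v y) * (1 + P.μ * X.γ v y) * X.h v y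

/-- A proper execution with valid parameters. -/
structure IsProperExecution (X : ClusterTrace n) (P : SyncParams) (f : ℕ) (F : Finset (Fin n)) :
    Prop where
  valid : P.Valid
  exec : X.IsExecution P f F
  proper : ∀ j, X.ProperRound P f F j

namespace IsProperExecution

variable {X : ClusterTrace n} {P : SyncParams} {f : ℕ} {F : Finset (Fin n)}
  (h : X.IsProperExecution P f F) {v : Fin n} (hv : v ∉ F)
include h hv

theorem t_le_s (j : ℕ) : X.t v j ≤ X.s v j :=
  (h.exec.start_le_pulse v hv j).trans (h.exec.pulse_le_phase v hv j)

theorem t_le_succ (j : ℕ) : X.t v j ≤ X.t v (j + 1) :=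
  (h.t_le_s hv j).trans (h.exec.phase_le_next v hv j)

theorem t_mono : Monotone (X.t v) := monotone_nat_of_le_succ (h.t_le_succ hv)

theorem t_nonneg (j : ℕ) : 0 ≤ X.t v j := by
  rw [← h.exec.start v hv]; exact h.t_mono hv (Nat.zero_le j)

/-- No regularity of δ is assumed, but δ is constant on each piece of a round, so the rate is a
bounded measurable factor times the integrable `h`. Without integrability the integral defining `L`
would take its default value 0. -/
theorem intervalIntegrable_of_control_const {a b D : ℝ} (hab : a ≤ b)
    (hD : ∀ x ∈ Set.Ico a b, X.δ v x = D) : IntervalIntegrable (X.rate P v) volume a b := by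
  rw [intervalIntegrable_iff_integrableOn_Ico_of_le hab]
  have h1 : IntegrableOn (X.h v) (Set.Ico a b) :=
    ((h.exec.hardware_locallyIntegrable v hv).integrableOn_isCompact isCompact_Icc).mono_set
      Set.Ico_subset_Icc_self
  have h2 : IntegrableOn (fun x => ((1 + P.φ * D) * (1 + P.μ * X.γ v x)) * X.h v x)
      (Set.Ico a b) := by
    refine Integrable.bdd_mul (c := |1 + P.φ * D| * (1 + P.μ)) h1 ?_ ?_
    · have := h.exec.mode_measurable v hv
      exact (by fun_prop : Measurable fun x => (1 + P.φ * D) * (1 + P.μ * X.γ v x)).aestronglyMeasurable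
    · refine ae_of_all _ fun x => ?_
      rw [Real.norm_eq_abs, abs_mul]
      refine mul_le_mul_of_nonneg_left ?_ (abs_nonneg _)
      have := h.valid.mu_nonneg
      rcases h.exec.mode_values v hv x with hx | hx <;> rw [hx, abs_of_nonneg (by linarith)] <;> linarith
  exact h2.congr_fun (fun x hx => by simp only [rate, hD x hx]) measurableSet_Ico

theorem intervalIntegrable_zero_t (j : ℕ) : IntervalIntegrable (X.rate P v) volume 0 (X.t v j) := by
  induction j with
  | zero => rw [h.exec.start v hv]
  | succ j ih =>
    exact (ih.trans (h.intervalIntegrable_of_control_const hv (h.t_le_s hv j)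
      (h.exec.control_phase12 v hv j))).trans
      (h.intervalIntegrable_of_control_const hv (h.exec.phase_le_next v hv j)
        (h.exec.control_phase3 v hv j))

theorem L_sub_eq_of_le_t {a b : ℝ} {j : ℕ} (ha : 0 ≤ a) (hab : a ≤ b) (hb : b ≤ X.t v j) :
    IntervalIntegrable (X.rate P v) volume a b ∧
      X.L P v b - X.L P v a = ∫ y in a..b, X.rate P v y := by
  have hI := h.intervalIntegrable_zero_t hv j
  have h0 := h.t_nonneg hv j
  have sub : ∀ {c e : ℝ}, 0 ≤ c → c ≤ e → e ≤ X.t v j →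
      IntervalIntegrable (X.rate P v) volume c e := fun hc hce he =>
    hI.mono_set (by rw [Set.uIcc_of_le hce, Set.uIcc_of_le h0]; exact Set.Icc_subset_Icc hc he)
  exact ⟨sub ha hab hb, intervalIntegral.integral_interval_sub_left
    (sub le_rfl (ha.trans hab) hb) (sub le_rfl ha (hab.trans hb))⟩

theorem L_sub_bounds_of_le_t {a b lo hi : ℝ} {j : ℕ} (ha : 0 ≤ a) (hab : a ≤ b) (hb : b ≤ X.t v j)
    (hr : ∀ x ∈ Set.Ico a b, lo ≤ X.rate P v x ∧ X.rate P v x ≤ hi) :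
    lo * (b - a) ≤ X.L P v b - X.L P v a ∧ X.L P v b - X.L P v a ≤ hi * (b - a) := by
  obtain ⟨hI, hL⟩ := h.L_sub_eq_of_le_t hv ha hab hb
  rw [hL]
  have e : ∀ c : ℝ, c * (b - a) = ∫ _ in a..b, c := fun c => by
    rw [intervalIntegral.integral_const, smul_eq_mul, mul_comm]
  rw [e lo, e hi]
  exact ⟨intervalIntegral.integral_mono_on_of_le_Ioo hab (by simp) hI
      fun x hx => (hr x (Set.Ioo_subset_Ico_self hx)).1,
    intervalIntegral.integral_mono_on_of_le_Ioo hab hI (by simp)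
      fun x hx => (hr x (Set.Ioo_subset_Ico_self hx)).2⟩

theorem rate_phase12_bounds {j : ℕ} {x : ℝ} (hx : x ∈ Set.Ico (X.t v j) (X.s v j)) :
    1 + P.φ ≤ X.rate P v x ∧ X.rate P v x ≤ P.zetaMax * P.thetaG := by
  obtain ⟨h1, h2⟩ := h.exec.hardware_bounds v hv x
  have hφ := h.valid.phi_pos
  have hμ := h.valid.mu_nonneg
  have hρ := h.valid.rho_pos
  unfold rate SyncParams.zetaMax SyncParams.thetaG
  rw [h.exec.control_phase12 v hv j x hx, mul_one]
  have hm : 1 ≤ 1 + P.μ * X.γ v x ∧ 1 + P.μ * X.γ v x ≤ 1 + P.μ := by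
    rcases h.exec.mode_values v hv x with hx | hx <;> rw [hx] <;> constructor <;> linarith
  have e1 : 1 + P.φ ≤ (1 + P.φ) * (1 + P.μ * X.γ v x) := le_mul_of_one_le_right (by linarith) hm.1
  constructor
  · exact e1.trans (le_mul_of_one_le_right (by linarith) h1)
  · refine mul_le_mul (mul_le_mul_of_nonneg_left hm.2 (by linarith))
      (h2.trans (le_mul_of_one_le_right (by linarith) (by linarith))) (by linarith) (by positivity)

theorem abs_corr_lt {j : ℕ} (hτ : 0 < P.tau3 j) : |X.corr P f v j| < P.tau3 j :=
  ((h.proper j).corr_le v hv).trans_lt (by nlinarith [h.valid.phi_lt_one])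

/-- The amortization factor in phase 3. -/
theorem control_factor_phase3 {j : ℕ} (hτ : 0 < P.tau3 j) {x : ℝ}
    (hx : x ∈ Set.Ico (X.s v j) (X.t v (j + 1))) :
    1 + P.φ * X.δ v x = (1 + P.φ) * (P.tau3 j / (P.tau3 j + X.corr P f v j)) := by
  have h1 := (abs_lt.1 (h.abs_corr_lt hv hτ)).1
  have h2 : P.tau3 j + X.corr P f v j ≠ 0 := by linarith
  have h3 := h.valid.phi_pos.ne'
  rw [h.exec.control_phase3 v hv j x hx]
  field_simp
  ring

theorem rate_nonneg_of_lt_t {j : ℕ} {x : ℝ} (hx : x ∈ Set.Ico 0 (X.t v j)) :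
    0 ≤ X.rate P v x := by
  have hφ := h.valid.phi_pos
  have hμ := h.valid.mu_nonneg
  induction j with
  | zero => rw [h.exec.start v hv] at hx; simp at hx
  | succ j ih =>
    rcases lt_or_ge x (X.t v j) with h1 | h1
    · exact ih ⟨hx.1, h1⟩
    rcases lt_or_ge x (X.s v j) with h2 | h2
    · linarith [(h.rate_phase12_bounds hv ⟨h1, h2⟩).1]
    have hd : 0 ≤ 1 + P.φ * X.δ v x := by
      -- If τ₃ = 0, properness forces Δ = 0, and the quotient 0/0 has the value 0, so δ = 1.
      rcases (h.valid.tau3_nonneg j).eq_or_lt' with h3 | h3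
      · have := (h.proper j).corr_le v hv
        rw [h3, mul_zero, abs_nonpos_iff] at this
        rw [h.exec.control_phase3 v hv j x ⟨h2, hx.2⟩, this]
        simp; linarith
      · rw [h.control_factor_phase3 hv h3 ⟨h2, hx.2⟩]
        have h4 := (abs_lt.1 (h.abs_corr_lt hv h3)).1
        have : 0 < P.tau3 j + X.corr P f v j := by linarith
        positivity
    have hm : 0 ≤ 1 + P.μ * X.γ v x := by
      rcases h.exec.mode_values v hv x with hx | hx <;> rw [hx] <;> linarith
    have := (h.exec.hardware_bounds v hv x).1
    unfold rate; positivity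

theorem L_mono_of_le_t {a b : ℝ} {j : ℕ} (ha : 0 ≤ a) (hab : a ≤ b) (hb : b ≤ X.t v j) :
    X.L P v a ≤ X.L P v b := by
  obtain ⟨-, hL⟩ := h.L_sub_eq_of_le_t hv ha hab hb
  have : 0 ≤ ∫ y in a..b, X.rate P v y := by
    rw [← intervalIntegral.integral_zero (a := a) (b := b) (μ := volume)]
    refine intervalIntegral.integral_mono_on_of_le_Ioo hab (by simp)
      (h.L_sub_eq_of_le_t hv ha hab hb).1 fun x hx => ?_
    exact h.rate_nonneg_of_lt_t hv ⟨ha.trans hx.1.le, hx.2.trans_le hb⟩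
  linarith

/-- Phases 1 and 2 have bounded length. -/
theorem phase12_length (j : ℕ) :
    2 * P.err j + P.d ≤ X.s v j - X.t v j ∧
      (1 + P.φ) * (X.s v j - X.t v j) ≤ P.tau1 j + P.tau2 j := by
  have h1 := h.L_sub_bounds_of_le_t hv (h.t_nonneg hv j) (h.t_le_s hv j)
    (h.exec.phase_le_next v hv j) fun x hx => h.rate_phase12_bounds hv hx
  have h2 := h.exec.phase_clock v hv j
  have hz : 0 < P.zetaMax * P.thetaG :=
    mul_pos h.valid.zetaMax_pos (by linarith [h.valid.one_le_thetaG])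
  refine ⟨?_, by linarith [h1.1]⟩
  refine le_of_mul_le_mul_left ?_ hz
  have : P.zetaMax * P.thetaG * (2 * P.err j + P.d) = P.tau1 j + P.tau2 j := by
    unfold SyncParams.tau1 SyncParams.tau2; ring
  linarith [h1.2]

/-- Round starts do not accumulate: each round takes at least time d. Every time therefore precedes
some round start, and rate bounds apply to arbitrary nonnegative times. -/
theorem mul_d_le_t (j : ℕ) : j * P.d ≤ X.t v j := by
  induction j with
  | zero => simpa using h.t_nonneg hv 0
  | succ j ih =>
    have h1 := (h.phase12_length hv j).1
    have h2 := h.exec.phase_le_next v hv j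
    have h3 := h.valid.err_nonneg j
    push_cast; linarith

theorem exists_le_t (x : ℝ) : ∃ j, x ≤ X.t v j := by
  obtain ⟨j, hj⟩ := exists_nat_ge (x / P.d)
  rw [div_le_iff₀ h.valid.d_pos] at hj
  exact ⟨j, hj.trans (h.mul_d_le_t hv j)⟩

theorem L_sub_bounds {a b lo hi : ℝ} (ha : 0 ≤ a) (hab : a ≤ b)
    (hr : ∀ x ∈ Set.Ico a b, lo ≤ X.rate P v x ∧ X.rate P v x ≤ hi) :
    lo * (b - a) ≤ X.L P v b - X.L P v a ∧ X.L P v b - X.L P v a ≤ hi * (b - a) := by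
  obtain ⟨j, hj⟩ := h.exists_le_t hv b
  exact h.L_sub_bounds_of_le_t hv ha hab hj hr

omit hv in
/-- Pulses of correct nodes arrive during phases 1 and 2. -/
theorem recv_mem {v w : Fin n} (hv : v ∉ F) (hw : w ∉ F) (j : ℕ) :
    X.recv w v j ∈ Set.Icc (X.t v j) (X.s v j) := by
  constructor
  · linarith [(h.exec.delay v hv w hw j).1, ((h.proper j).in_round v hv w hw).1, h.valid.U_le_d]
  · by_contra! hc
    obtain ⟨i, hi⟩ := h.exists_le_t hv (X.recv w v j)
    have h1 := h.L_mono_of_le_t hv ((h.t_nonneg hv j).trans (h.t_le_s hv j)) hc.le hi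
    linarith [(h.proper j).received v hv w hw, h.exec.phase_clock v hv j]

omit hv in
/-- Properness alone bounds the pulse skew. -/
theorem pulse_skew_le {v w : Fin n} (hv : v ∉ F) (hw : w ∉ F) (j : ℕ) :
    X.p v j - X.p w j ≤ (1 + P.μ) * P.thetaG * (2 * P.err j + P.d) - P.d + P.U := by
  have h1 := (h.phase12_length hw j).2
  have h2 := (h.recv_mem hw hv j).2
  have h3 := (h.exec.delay w hw v hv j).1
  have h4 := h.exec.start_le_pulse w hw j
  have h5 : P.tau1 j + P.tau2 j = (1 + P.φ) * ((1 + P.μ) * P.thetaG * (2 * P.err j + P.d)) := by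
    unfold SyncParams.tau1 SyncParams.tau2 SyncParams.zetaMax; ring
  rw [h5] at h1
  have := le_of_mul_le_mul_left h1 (by linarith [h.valid.phi_pos])
  linarith

end IsProperExecution
end ClusterTrace

/-! ### Rounds in which all correct nodes have the same mode -/

namespace ClusterTrace

variable {n : ℕ}

/-- The mode of all correct nodes is `c` in round `j`. -/
def UnanimousRound (X : ClusterTrace n) (F : Finset (Fin n)) (c : ℝ) (j : ℕ) : Prop :=
  ∀ v ∉ F, ∀ x ∈ Set.Icc (X.t v j) (X.t v (j + 1)), X.γ v x = c

/-- The pulses of round `j` of correct nodes are sent within a time interval of length `E`. -/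
def PulseSkewLE (X : ClusterTrace n) (F : Finset (Fin n)) (j : ℕ) (E : ℝ) : Prop :=
  ∀ v ∉ F, ∀ w ∉ F, X.p v j - X.p w j ≤ E

end ClusterTrace

/-- The nominal clock rate in mode `c`. -/
def SyncParams.nominalRate (P : SyncParams) (c : ℝ) : ℝ := (1 + P.φ) * (1 + P.μ * c)

/-- The logical duration of round `j`. -/
def SyncParams.roundLength (P : SyncParams) (j : ℕ) : ℝ := P.tau1 j + P.tau2 j + P.tau3 j

namespace SyncParams.Valid

variable {P : SyncParams} (hP : P.Valid) {c : ℝ} (hc : c = 0 ∨ c = 1)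
include hP hc

theorem one_add_phi_le_nominalRate : 1 + P.φ ≤ P.nominalRate c := by
  have := hP.phi_pos
  have := hP.mu_nonneg
  unfold nominalRate
  rcases hc with rfl | rfl <;> nlinarith

theorem nominalRate_le_zetaMax : P.nominalRate c ≤ P.zetaMax := by
  have := hP.phi_pos
  have := hP.mu_nonneg
  unfold nominalRate zetaMax
  rcases hc with rfl | rfl <;> nlinarith

theorem nominalRate_pos : 0 < P.nominalRate c := by
  linarith [hP.one_add_phi_le_nominalRate hc, hP.phi_pos]

/-- Phase durations are defined with the worst-case rate. This converts them to real time at the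
nominal rate, at the cost of the factor (1 + μ)ϑ, whichever mode is in force. -/
theorem zetaMax_mul_thetaG_mul_le {y : ℝ} (hy : 0 ≤ y) :
    P.zetaMax * P.thetaG * y ≤ P.nominalRate c * ((1 + P.μ) * P.thetaG * y) := by
  have h1 := hP.one_add_phi_le_nominalRate hc
  have h2 := hP.one_le_thetaG
  have h3 := hP.mu_nonneg
  have : 0 ≤ (1 + P.μ) * P.thetaG * y := by positivity
  calc P.zetaMax * P.thetaG * y = (1 + P.φ) * ((1 + P.μ) * P.thetaG * y) := by
        unfold zetaMax; ring
    _ ≤ _ := mul_le_mul_of_nonneg_right h1 this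

end SyncParams.Valid

namespace ClusterTrace.IsProperExecution

variable {n : ℕ} {X : ClusterTrace n} {P : SyncParams} {f : ℕ} {F : Finset (Fin n)}
  (h : X.IsProperExecution P f F) {c : ℝ} (hc : c = 0 ∨ c = 1) {v : Fin n} (hv : v ∉ F)
  {j : ℕ} (hj : X.UnanimousRound F c j)
include h hc hv hj

theorem mode_rate_bounds {x : ℝ} (hx : x ∈ Set.Icc (X.t v j) (X.t v (j + 1))) :
    P.nominalRate c ≤ (1 + P.φ) * (1 + P.μ * X.γ v x) * X.h v x ∧
      (1 + P.φ) * (1 + P.μ * X.γ v x) * X.h v x ≤ P.nominalRate c * (1 + P.ρ) := by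
  obtain ⟨h1, h2⟩ := h.exec.hardware_bounds v hv x
  have hz := h.valid.nominalRate_pos hc
  have e : (1 + P.φ) * (1 + P.μ * X.γ v x) = P.nominalRate c := by rw [hj v hv x hx]; rfl
  rw [e]
  exact ⟨le_mul_of_one_le_right hz.le h1, mul_le_mul_of_nonneg_left h2 hz.le⟩

theorem advance_phase12 {a b : ℝ} (ha : X.t v j ≤ a) (hab : a ≤ b) (hb : b ≤ X.s v j) :
    P.nominalRate c * (b - a) ≤ X.L P v b - X.L P v a ∧
      X.L P v b - X.L P v a ≤ P.nominalRate c * (1 + P.ρ) * (b - a) := by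
  refine h.L_sub_bounds hv ((h.t_nonneg hv j).trans ha) hab fun x hx => ?_
  have hx' : x ∈ Set.Ico (X.t v j) (X.s v j) := ⟨ha.trans hx.1, hx.2.trans_le hb⟩
  unfold rate
  rw [h.exec.control_phase12 v hv j x hx', mul_one]
  exact h.mode_rate_bounds hc hv hj ⟨hx'.1, hx'.2.le.trans (h.exec.phase_le_next v hv j)⟩

theorem rate_phase3 (hτ : 0 < P.tau3 j) {x : ℝ} (hx : x ∈ Set.Ico (X.s v j) (X.t v (j + 1))) :
    P.nominalRate c * (P.tau3 j / (P.tau3 j + X.corr P f v j)) ≤ X.rate P v x ∧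
      X.rate P v x ≤
        P.nominalRate c * (1 + P.ρ) * (P.tau3 j / (P.tau3 j + X.corr P f v j)) := by
  have h1 := h.mode_rate_bounds hc hv hj ⟨(h.t_le_s hv j).trans hx.1, hx.2.le⟩
  have h2 := (abs_lt.1 (h.abs_corr_lt hv hτ)).1
  have h3 : 0 ≤ P.tau3 j / (P.tau3 j + X.corr P f v j) := div_nonneg hτ.le (by linarith)
  have e : X.rate P v x = (1 + P.φ) * (1 + P.μ * X.γ v x) * X.h v x
      * (P.tau3 j / (P.tau3 j + X.corr P f v j)) := by
    unfold rate
    rw [h.control_factor_phase3 hv hτ hx]; ring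
  rw [e]
  exact ⟨mul_le_mul_of_nonneg_right h1.1 h3, mul_le_mul_of_nonneg_right h1.2 h3⟩

/-- In phase 3 the nominal clock advances by `τ₃ + Δ`. -/
theorem length_phase3 (hτ : 0 < P.tau3 j) :
    P.nominalRate c * (X.t v (j + 1) - X.s v j) ≤ P.tau3 j + X.corr P f v j ∧
      P.tau3 j + X.corr P f v j ≤ P.nominalRate c * (1 + P.ρ) * (X.t v (j + 1) - X.s v j) := by
  have h1 := h.L_sub_bounds hv ((h.t_nonneg hv j).trans (h.t_le_s hv j))
    (h.exec.phase_le_next v hv j) fun x hx => h.rate_phase3 hc hv hj hτ hx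
  have h2 := (abs_lt.1 (h.abs_corr_lt hv hτ)).1
  have h3 : 0 < P.tau3 j + X.corr P f v j := by linarith
  have h4 : X.L P v (X.t v (j + 1)) - X.L P v (X.s v j) = P.tau3 j := by
    linarith [h.exec.next_clock v hv j, h.exec.phase_clock v hv j]
  rw [h4] at h1
  have key : ∀ y : ℝ, y * (P.tau3 j / (P.tau3 j + X.corr P f v j)) * (X.t v (j + 1) - X.s v j)
      = P.tau3 j * (y * (X.t v (j + 1) - X.s v j) / (P.tau3 j + X.corr P f v j)) := fun y => by
    ring
  rw [key, key] at h1
  constructor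
  · have := le_of_mul_le_mul_left (h1.1.trans_eq (mul_one _).symm) hτ
    rwa [div_le_one h3] at this
  · have := le_of_mul_le_mul_left ((mul_one _).trans_le h1.2) hτ
    rwa [one_le_div h3] at this

/-- In a unanimous round with small correction, a clock runs nearly at the nominal rate. -/
theorem advance_round {x : ℝ} (hx0 : 0 ≤ x) (hx1 : x ≤ 1 / 2) (hτ : 0 < P.tau3 j)
    (hΔ : |X.corr P f v j| ≤ x * P.tau3 j) {a b : ℝ}
    (ha : a ∈ Set.Icc (X.t v j) (X.t v (j + 1))) (hb : b ∈ Set.Icc (X.t v j) (X.t v (j + 1))) :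
    |X.L P v b - X.L P v a - P.nominalRate c * (b - a)|
      ≤ P.nominalRate c * ((P.ρ + 2 * x + 2 * x * P.ρ) * |b - a|) := by
  have hz := h.valid.nominalRate_pos hc
  have hρ := h.valid.rho_pos
  wlog hab : a ≤ b generalizing a b with H
  · have := H hb ha (le_of_not_ge hab)
    rw [abs_sub_comm b a, ← abs_neg]
    convert this using 2
    ring
  -- The quotient lies between 1/(1 + x) and 1/(1 - x); the bound 1/(1 - x) ≤ 1 + 2x uses x ≤ 1/2.
  have hq : 1 - x ≤ P.tau3 j / (P.tau3 j + X.corr P f v j) ∧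
      P.tau3 j / (P.tau3 j + X.corr P f v j) ≤ 1 + 2 * x := by
    obtain ⟨h1, h2⟩ := abs_le.1 hΔ
    have h3 : 0 < P.tau3 j + X.corr P f v j := by nlinarith
    rw [le_div_iff₀ h3, div_le_iff₀ h3]
    constructor <;> nlinarith [mul_nonneg hx0 hτ.le, mul_nonneg hx0 (mul_nonneg hx0 hτ.le)]
  have h1 := h.L_sub_bounds hv (lo := P.nominalRate c * (1 - x))
    (hi := P.nominalRate c * (1 + P.ρ) * (1 + 2 * x)) ((h.t_nonneg hv j).trans ha.1) hab
    fun y hy => by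
      rcases lt_or_ge y (X.s v j) with hs | hs
      · have := h.mode_rate_bounds hc hv hj ⟨ha.1.trans hy.1, hy.2.le.trans hb.2⟩
        have e : X.rate P v y = (1 + P.φ) * (1 + P.μ * X.γ v y) * X.h v y := by
          unfold rate
          rw [h.exec.control_phase12 v hv j y ⟨ha.1.trans hy.1, hs⟩, mul_one]
        rw [e]
        constructor
        · nlinarith
        · have : 0 < P.nominalRate c * (1 + P.ρ) := by positivity
          nlinarith
      · have := h.rate_phase3 hc hv hj hτ ⟨hs, hy.2.trans_le hb.2⟩
        exact ⟨(mul_le_mul_of_nonneg_left hq.1 hz.le).trans this.1,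
          this.2.trans (mul_le_mul_of_nonneg_left hq.2 (by positivity))⟩
  have hba : 0 ≤ P.nominalRate c * (b - a) := mul_nonneg hz.le (by linarith)
  rw [abs_of_nonneg (sub_nonneg.2 hab), abs_le]
  have i1 : 0 ≤ P.nominalRate c * (b - a) * P.ρ := mul_nonneg hba hρ.le
  have i2 : 0 ≤ P.nominalRate c * (b - a) * x := mul_nonneg hba hx0
  have i3 : 0 ≤ P.nominalRate c * (b - a) * x * P.ρ := mul_nonneg i2 hρ.le
  constructor <;> nlinarith [h1.1, h1.2]

omit hv in
/-- The clock values compared by `v` reflect the pulse times. -/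
theorem offset_bounds {v w : Fin n} (hv : v ∉ F) (hw : w ∉ F) {E : ℝ} (hE : X.PulseSkewLE F j E) :
    |X.L P v (X.recv w v j) - X.L P v (X.recv v v j) - P.nominalRate c * (X.p w j - X.p v j)|
        ≤ P.nominalRate c * (P.U + P.ρ * (E + P.U)) ∧
      |X.L P v (X.recv w v j) - X.L P v (X.recv v v j)|
        ≤ P.nominalRate c * ((1 + P.ρ) * (E + P.U)) := by
  have hz := h.valid.nominalRate_pos hc
  have hρ := h.valid.rho_pos
  obtain ⟨d1, d2⟩ := h.exec.delay v hv w hw j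
  obtain ⟨d3, d4⟩ := h.exec.delay v hv v hv j
  obtain ⟨r1, r2⟩ := h.recv_mem hv hw j
  obtain ⟨r3, r4⟩ := h.recv_mem hv hv j
  have e1 := hE v hv w hw
  have e2 := hE w hw v hv
  have m1 : ∀ {a b : ℝ}, a ≤ b → P.nominalRate c * a ≤ P.nominalRate c * b := fun hab =>
    mul_le_mul_of_nonneg_left hab hz.le
  rcases le_total (X.recv v v j) (X.recv w v j) with hle | hle
  · obtain ⟨b1, b2⟩ := h.advance_phase12 hc hv hj r3 hle r2
    have k1 := m1 (show X.recv w v j - X.recv v v j ≤ E + P.U by linarith)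
    have k2 := mul_le_mul_of_nonneg_right k1 hρ.le
    have k3 := m1 (show X.recv w v j - X.recv v v j ≤ X.p w j - X.p v j + P.U by linarith)
    have k4 := m1 (show X.p w j - X.p v j - P.U ≤ X.recv w v j - X.recv v v j by linarith)
    have k5 := m1 (show 0 ≤ X.recv w v j - X.recv v v j by linarith)
    have k6 := mul_le_mul_of_nonneg_right k5 hρ.le
    rw [abs_le, abs_le]
    refine ⟨⟨?_, ?_⟩, ?_, ?_⟩ <;> linarith
  · obtain ⟨b1, b2⟩ := h.advance_phase12 hc hv hj r1 hle r4
    have k1 := m1 (show X.recv v v j - X.recv w v j ≤ E + P.U by linarith)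
    have k2 := mul_le_mul_of_nonneg_right k1 hρ.le
    have k3 := m1 (show X.recv w v j - X.recv v v j ≤ X.p w j - X.p v j + P.U by linarith)
    have k4 := m1 (show X.p w j - X.p v j - P.U ≤ X.recv w v j - X.recv v v j by linarith)
    have k5 := m1 (show 0 ≤ X.recv v v j - X.recv w v j by linarith)
    have k6 := mul_le_mul_of_nonneg_right k5 hρ.le
    rw [abs_le, abs_le]
    refine ⟨⟨?_, ?_⟩, ?_, ?_⟩ <;> linarith

omit hv in
/-- The corrections of all correct nodes agree up to half of the pulse skew. -/
theorem exists_corr_mem (hn : 3 * f + 1 ≤ n) (hF : F.card ≤ f) {E : ℝ}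
    (hE : X.PulseSkewLE F j E) :
    ∃ a, ∀ v ∉ F,
      a - P.nominalRate c * (P.U + P.ρ * (E + P.U))
          ≤ X.corr P f v j + P.nominalRate c * X.p v j ∧
        X.corr P f v j + P.nominalRate c * X.p v j
          ≤ a + P.nominalRate c * (E / 2 + (P.U + P.ρ * (E + P.U))) := by
  have hz := h.valid.nominalRate_pos hc
  have hne : Fᶜ.Nonempty := by
    rw [← Finset.card_pos, Finset.card_compl, Fintype.card_fin]; omega
  obtain ⟨w₀, hw₀, hmin⟩ := Finset.exists_min_image Fᶜ (fun w => X.p w j) hne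
  rw [Finset.mem_compl] at hw₀
  obtain ⟨m, -, -, hm⟩ := exists_trimmedMidpoint_mem F hn hF (fun w => P.nominalRate c * X.p w j)
    (a := P.nominalRate c * X.p w₀ j) (b := P.nominalRate c * (X.p w₀ j + E)) fun w hw =>
    ⟨mul_le_mul_of_nonneg_left (hmin w (by simpa using hw)) hz.le,
      mul_le_mul_of_nonneg_left (by linarith [hE w hw w₀ hw₀]) hz.le⟩
  refine ⟨(P.nominalRate c * X.p w₀ j + m) / 2, fun v hv => ?_⟩
  have := hm (fun w => X.L P v (X.recv w v j) - X.L P v (X.recv v v j))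
    (-(P.nominalRate c * X.p v j) - P.nominalRate c * (P.U + P.ρ * (E + P.U)))
    (-(P.nominalRate c * X.p v j) + P.nominalRate c * (P.U + P.ρ * (E + P.U))) fun w hw => by
      have := abs_le.1 (h.offset_bounds hc hj hv hw hE).1
      constructor <;> linarith
  unfold corr
  constructor <;> linarith

theorem abs_corr_le (hn : 3 * f + 1 ≤ n) (hF : F.card ≤ f) {E : ℝ} (hE : X.PulseSkewLE F j E) :
    |X.corr P f v j| ≤ P.nominalRate c * ((1 + P.ρ) * (E + P.U)) := by
  -- With all reference values 0, the agreement lemma says that the midpoint obeys any bounds obeyed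
  -- by all correct values.
  obtain ⟨m, m1, m2, hm⟩ := exists_trimmedMidpoint_mem F hn hF (fun _ => 0) (a := 0) (b := 0)
    (by simp)
  have := hm (fun w => X.L P v (X.recv w v j) - X.L P v (X.recv v v j))
    (-(P.nominalRate c * ((1 + P.ρ) * (E + P.U)))) (P.nominalRate c * ((1 + P.ρ) * (E + P.U)))
    fun w hw => by
      have := abs_le.1 (h.offset_bounds hc hj hv hw hE).2
      constructor <;> linarith
  unfold corr
  rw [abs_le]
  constructor <;> linarith

theorem length_phase1 :
    P.nominalRate c * (X.p v j - X.t v j) ≤ P.tau1 j ∧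
      P.tau1 j ≤ P.nominalRate c * (1 + P.ρ) * (X.p v j - X.t v j) := by
  have h1 := h.advance_phase12 hc hv hj le_rfl (h.exec.start_le_pulse v hv j)
    (h.exec.pulse_le_phase v hv j)
  have h2 := h.exec.pulse_clock v hv j
  constructor <;> linarith [h1.1, h1.2]

theorem length_phase2 :
    P.nominalRate c * (X.s v j - X.p v j) ≤ P.tau2 j ∧
      P.tau2 j ≤ P.nominalRate c * (1 + P.ρ) * (X.s v j - X.p v j) := by
  have h1 := h.advance_phase12 hc hv hj (h.exec.start_le_pulse v hv j)
    (h.exec.pulse_le_phase v hv j) le_rfl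
  have h2 := h.exec.pulse_clock v hv j
  have h3 := h.exec.phase_clock v hv j
  constructor <;> linarith [h1.1, h1.2]

theorem length_round (hτ : 0 < P.tau3 j) :
    P.nominalRate c * (X.t v (j + 1) - X.t v j) ≤ P.roundLength j + X.corr P f v j ∧
      P.roundLength j + X.corr P f v j
        ≤ P.nominalRate c * (1 + P.ρ) * (X.t v (j + 1) - X.t v j) := by
  have h1 := h.length_phase1 hc hv hj
  have h2 := h.length_phase2 hc hv hj
  have h3 := h.length_phase3 hc hv hj hτ
  unfold SyncParams.roundLength
  constructor <;> linarith [h1.1, h1.2, h2.1, h2.2, h3.1, h3.2]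

omit hv in
-- Between consecutive pulses the nominal clock of v advances by K + Δ_v with K common to all nodes,
-- up to the factor 1 + ρ. So the new skew is the spread of ζp_v + Δ_v, where the old skew has been
-- halved, plus drift ρ(K + Δ).
theorem pulse_skew_step (hn : 3 * f + 1 ≤ n) (hF : F.card ≤ f)
    (hj1 : X.UnanimousRound F c (j + 1)) (hτ : 0 < P.tau3 j) {E : ℝ}
    (hE : X.PulseSkewLE F j E) :
    X.PulseSkewLE F (j + 1) (E / 2 + 2 * P.U + 2 * P.ρ * (E + P.U)
      + P.ρ * ((1 + P.ρ) * (E + P.U)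
        + (1 + P.μ) * P.thetaG * (P.err j + P.d + P.c₁ * (P.err j + P.U) + P.err (j + 1)))) := by
  intro v hv w hw
  have hz := h.valid.nominalRate_pos hc
  have hρ := h.valid.rho_pos
  have hU := h.valid.U_nonneg
  obtain ⟨a, ha⟩ := h.exists_corr_mem hc hj hn hF hE
  have a1 := (ha v hv).2
  have a2 := (ha w hw).1
  have v2 := (h.length_phase2 hc hv hj).1
  have v3 := (h.length_phase3 hc hv hj hτ).1
  have v1 := (h.length_phase1 hc hv hj1).1
  have w2 := (h.length_phase2 hc hw hj).2
  have w3 := (h.length_phase3 hc hw hj hτ).2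
  have w1 := (h.length_phase1 hc hw hj1).2
  have hΔ := abs_le.1 (h.abs_corr_le hc hw hj hn hF hE)
  set K := P.tau2 j + P.tau3 j + P.tau1 (j + 1) with hK
  have hKle : K ≤ P.nominalRate c * ((1 + P.μ) * P.thetaG *
      (P.err j + P.d + P.c₁ * (P.err j + P.U) + P.err (j + 1))) := by
    have c1 := h.valid.one_lt_c₁
    have e1 := h.valid.err_nonneg j
    have e2 := h.valid.err_nonneg (j + 1)
    have dd := h.valid.d_pos
    refine le_of_eq_of_le ?_ (h.valid.zetaMax_mul_thetaG_mul_le hc (by positivity))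
    rw [hK]; unfold SyncParams.tau1 SyncParams.tau2 SyncParams.tau3; ring
  have w4 : K + X.corr P f w j ≤ P.nominalRate c * (X.p w (j + 1) - X.p w j) * (1 + P.ρ) := by
    rw [hK]; linarith
  -- Division by 1 + ρ is replaced by multiplication by 1 - ρ, since (1 + ρ)(1 - ρ) ≤ 1.
  have w5 : (K + X.corr P f w j) * (1 - P.ρ) ≤ P.nominalRate c * (X.p w (j + 1) - X.p w j) := by
    refine le_of_mul_le_mul_right (le_trans ?_ w4) (show 0 < 1 + P.ρ by linarith)
    have t3 := (abs_lt.1 (h.abs_corr_lt hw hτ)).1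
    have : 0 ≤ K + X.corr P f w j := by
      linarith [(h.valid.tau2_pos j), h.valid.tau1_nonneg (j + 1)]
    nlinarith [mul_nonneg this (sq_nonneg P.ρ)]
  have w6 := mul_le_mul_of_nonneg_left (add_le_add hKle hΔ.2) hρ.le
  refine le_of_mul_le_mul_left ?_ hz
  linarith

omit hj hv

/-- A round of `v` as measured by the clock of `v`. -/
theorem advance_own_round (hn : 3 * f + 1 ≤ n) (hF : F.card ≤ f) {i : ℕ}
    (hi : X.UnanimousRound F c i) (hτ : 0 < P.tau3 i) {E : ℝ} (hE : X.PulseSkewLE F i E)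
    {T : ℝ} (hT : P.roundLength i = P.nominalRate c * T) {v : Fin n} (hv : v ∉ F) :
    X.L P v (X.t v (i + 1)) - X.L P v (X.t v i) = P.nominalRate c * T ∧
      X.t v (i + 1) - X.t v i ≤ T + (1 + P.ρ) * (E + P.U) ∧
      T - (1 + P.ρ) * (E + P.U) ≤ (1 + P.ρ) * (X.t v (i + 1) - X.t v i) := by
  have hz := h.valid.nominalRate_pos hc
  have h1 := h.length_round hc hv hi hτ
  have h2 := abs_le.1 (h.abs_corr_le hc hv hi hn hF hE)
  refine ⟨?_, le_of_mul_le_mul_left ?_ hz, le_of_mul_le_mul_left ?_ hz⟩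
  · have := h.exec.next_clock v hv i
    unfold SyncParams.roundLength at hT
    linarith
  · linarith
  · linarith

/-- Phase 1 has the same logical duration at all nodes, so its real durations agree up to the factor
1 + ρ and the pulse skew carries back to the starts. -/
theorem start_skew_le {i : ℕ} (hi : X.UnanimousRound F c i) {E : ℝ} (hE : X.PulseSkewLE F i E)
    {v w : Fin n} (hv : v ∉ F) (hw : w ∉ F) :
    |X.t v i - X.t w i| ≤ E + P.ρ * ((1 + P.μ) * P.thetaG * P.err i) := by
  have hz := h.valid.nominalRate_pos hc
  have hρ := h.valid.rho_pos
  have key : ∀ {v w : Fin n}, v ∉ F → w ∉ F →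
      X.t v i - X.t w i ≤ E + P.ρ * ((1 + P.μ) * P.thetaG * P.err i) := by
    intro v w hv hw
    have h1 := (h.length_phase1 hc hv hi).2
    have h2 := (h.length_phase1 hc hw hi).1
    have h3 : P.tau1 i ≤ _ := h.valid.zetaMax_mul_thetaG_mul_le hc (h.valid.err_nonneg i)
    have h4 : X.p v i - X.t v i ≤ (1 + P.μ) * P.thetaG * P.err i :=
      le_of_mul_le_mul_left ((h.length_phase1 hc hv hi).1.trans h3) hz
    have h5 : X.p w i - X.t w i ≤ (1 + P.ρ) * (X.p v i - X.t v i) :=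
      le_of_mul_le_mul_left (by linarith) hz
    linarith [hE v hv w hw, mul_le_mul_of_nonneg_left h4 hρ.le]
  rw [abs_le]
  constructor <;> linarith [key hv hw, key hw hv]

/-- A round of `v` as measured by the clock of `w`. -/
theorem advance_other_round (hn : 3 * f + 1 ≤ n) (hF : F.card ≤ f) {i : ℕ}
    (hi : ∀ j, i ≤ j → j ≤ i + 2 → X.UnanimousRound F c j)
    {x : ℝ} (hx0 : 0 ≤ x) (hx1 : x ≤ 1 / 2)
    (hτ : ∀ j, i ≤ j → j ≤ i + 2 → 0 < P.tau3 j)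
    (hx : ∀ j, i ≤ j → j ≤ i + 2 → ∀ v ∉ F, |X.corr P f v j| ≤ x * P.tau3 j)
    {E : ℝ} (hE0 : 0 ≤ E) (hE : X.PulseSkewLE F (i + 1) E)
    {T : ℝ} (hT : P.roundLength (i + 1) = P.nominalRate c * T)
    {Y S : ℝ} (hS : S = 2 * (E + P.ρ * ((1 + P.μ) * P.thetaG * P.err (i + 1)))
      + 2 * ((1 + P.ρ) * (E + P.U)) + P.ρ * T)
    (hY : Y = (1 + P.ρ) * (E + P.U) + (P.ρ + 2 * x + 2 * x * P.ρ) * S)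
    {v w : Fin n} (hv : v ∉ F) (hw : w ∉ F) :
    P.nominalRate c * (X.t v (i + 2) - X.t v (i + 1) - Y)
        ≤ X.L P w (X.t v (i + 2)) - X.L P w (X.t v (i + 1)) ∧
      X.L P w (X.t v (i + 2)) - X.L P w (X.t v (i + 1))
        ≤ P.nominalRate c * (X.t v (i + 2) - X.t v (i + 1) + Y + P.ρ * T) := by
  have hz := h.valid.nominalRate_pos hc
  have hρ := h.valid.rho_pos
  have hU := h.valid.U_nonneg
  have hu1 := hi (i + 1) (by omega) (by omega)
  have hτ1 := hτ (i + 1) (by omega) (by omega)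
  have hT0 : 0 ≤ T := by
    have : 0 ≤ P.nominalRate c * T := by
      rw [← hT]; unfold SyncParams.roundLength
      linarith [h.valid.tau1_nonneg (i + 1), h.valid.tau2_pos (i + 1)]
    exact nonneg_of_mul_nonneg_right this hz
  obtain ⟨w0, w1, w2⟩ := h.advance_own_round hc hn hF hu1 hτ1 hE hT hw
  obtain ⟨v0, v1, v2⟩ := h.advance_own_round hc hn hF hu1 hτ1 hE hT hv
  have sA := h.start_skew_le hc hu1 hE hv hw
  -- Properness places each start of v within the two rounds of w adjacent to the corresponding
  -- start of w, so w is almost nominal between the two starts.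
  have near : ∀ j, i + 1 ≤ j → j ≤ i + 2 →
      |X.L P w (X.t v j) - X.L P w (X.t w j) - P.nominalRate c * (X.t v j - X.t w j)|
        ≤ P.nominalRate c * ((P.ρ + 2 * x + 2 * x * P.ρ) * |X.t v j - X.t w j|) := by
    intro j hj1 hj2
    obtain ⟨j, rfl⟩ : ∃ j', j = j' + 1 := ⟨j - 1, by omega⟩
    have q1 := (h.exec.start_le_pulse w hw j).trans
      ((h.proper j).in_round v hv w hw).2.le
    have q2 := ((h.proper (j + 1)).in_round v hv w hw).1.trans
      ((h.proper (j + 1)).in_round w hw w hw).2.le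
    rcases le_total (X.t v (j + 1)) (X.t w (j + 1)) with hle | hle
    · exact h.advance_round hc hw (hi j (by omega) (by omega)) hx0 hx1 (hτ j (by omega) (by omega))
        (hx j (by omega) (by omega) w hw) ⟨h.t_le_succ hw j, le_rfl⟩ ⟨q1, hle⟩
    · exact h.advance_round hc hw (hi (j + 1) (by omega) (by omega)) hx0 hx1
        (hτ (j + 1) (by omega) (by omega))
        (hx (j + 1) (by omega) (by omega) w hw) ⟨le_rfl, h.t_le_succ hw (j + 1)⟩ ⟨hle, q2⟩
  have nA := near (i + 1) le_rfl (by omega)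
  have nB := near (i + 2) (by omega) le_rfl
  have lower : ∀ {D : ℝ}, T - (1 + P.ρ) * (E + P.U) ≤ (1 + P.ρ) * D →
      T - (1 + P.ρ) * (E + P.U) - P.ρ * T ≤ D := by
    intro D hD
    have : 0 ≤ (1 + P.ρ) * (E + P.U) := by positivity
    nlinarith [mul_nonneg hρ.le this, mul_nonneg hρ.le (mul_nonneg hρ.le hT0)]
  have lw := lower w2
  have lv := lower v2
  have sB : |X.t v (i + 2) - X.t w (i + 2)| ≤ E + P.ρ * ((1 + P.μ) * P.thetaG * P.err (i + 1))
      + 2 * ((1 + P.ρ) * (E + P.U)) + P.ρ * T := by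
    rw [abs_le] at sA ⊢
    simp only [show i + 1 + 1 = i + 2 from rfl] at *
    constructor <;> linarith [sA.1, sA.2]
  have hy : 0 ≤ P.ρ + 2 * x + 2 * x * P.ρ := by positivity
  -- S bounds the sum of the start skews at both ends of the round.
  have sum : P.nominalRate c * ((P.ρ + 2 * x + 2 * x * P.ρ) * |X.t v (i + 1) - X.t w (i + 1)|)
      + P.nominalRate c * ((P.ρ + 2 * x + 2 * x * P.ρ) * |X.t v (i + 2) - X.t w (i + 2)|)
      ≤ P.nominalRate c * ((P.ρ + 2 * x + 2 * x * P.ρ) * S) := by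
    rw [← mul_add, ← mul_add]
    gcongr
    rw [hS]; linarith
  have zl := mul_le_mul_of_nonneg_left lw hz.le
  have zw := mul_le_mul_of_nonneg_left w1 hz.le
  obtain ⟨nA1, nA2⟩ := abs_le.1 nA
  obtain ⟨nB1, nB2⟩ := abs_le.1 nB
  simp only [show i + 1 + 1 = i + 2 from rfl] at *
  rw [hY]
  constructor <;> linarith

end ClusterTrace.IsProperExecution

/-! ### Numerical estimates for the tuned parameters -/

namespace SyncParams

/-- The value of `coefGamma` in a general execution. -/
def gain (P : SyncParams) : ℝ := (1 + P.μ) * (P.thetaG - 1)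

/-- The stretch factor for which the coefficient `α` of the error recursion is `999 / 1000`. -/
def stretch (ρ μ : ℝ) : ℝ :=
  let θ := (1 + ρ) * (1 + μ)
  let g := (1 + μ) * (θ - 1)
  (999 / 1000 * (1 - g) - (2 * θ ^ 2 + 5 * θ - 5) / (2 * (θ + 1))) / g - 1

/-- Parameters with small drift and a stretch factor for which the error recursion contracts at
rate `999 / 1000`. -/
structure Tuned (P : SyncParams) : Prop where
  rho_pos : 0 < P.ρ
  rho_le_mu : 32 * P.ρ ≤ P.μ
  drift_le_gain : P.ρ + P.μ ≤ P.gain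
  gain_le_drift : P.gain ≤ 1001 / 1000 * (P.ρ + P.μ)
  gain_small : P.gain ≤ 1 / 1000000
  one_le_thetaG : 1 ≤ P.thetaG
  mul_thetaG_le : (1 + P.μ) * P.thetaG ≤ 1 + 2 * P.gain
  le_gain_mul_c₁ : 498 / 1000 ≤ P.gain * P.c₁
  gain_mul_c₁_le : P.gain * P.c₁ ≤ 1 / 2
  d_pos : 0 < P.d
  U_nonneg : 0 ≤ P.U
  alpha_eq : P.coefAlpha (1 + P.φ) P.thetaG = 999 / 1000
  le_beta : P.gain * P.d + 2 * P.U ≤ P.coefBeta (1 + P.φ) P.thetaG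

theorem tuned_of_stretch {P : SyncParams} {c₂ : ℝ} (hc₂ : 32 ≤ c₂) (hρ : 0 < P.ρ)
    (hρ' : P.ρ * (1 + c₂) ≤ 1 / 10000000) (hμ : P.μ = c₂ * P.ρ) (hc₁ : P.c₁ = stretch P.ρ P.μ)
    (hφ : 0 < 1 + P.φ) (hd : 0 < P.d) (hU : 0 ≤ P.U) : P.Tuned := by
  have hμ0 : 32 * P.ρ ≤ P.μ := by rw [hμ]; nlinarith
  have hs : P.ρ + P.μ ≤ 1 / 10000000 := by rw [hμ]; linarith
  have hμp : 0 < P.μ := by linarith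
  have hθ : P.thetaG = 1 + (P.ρ + P.μ) + P.ρ * P.μ := by unfold thetaG; ring
  have hρμ : P.ρ * P.μ ≤ 1 / 10000000 * (P.ρ + P.μ) := by nlinarith
  have hρμ0 : 0 < P.ρ * P.μ := by positivity
  set s := P.ρ + P.μ with hsdef
  have hs0 : 0 < s := by positivity
  have hμs : P.μ ≤ s := by linarith
  set t := P.thetaG - 1 with htdef
  have ht1 : s ≤ t := by linarith
  have ht2 : t ≤ s + 1 / 10000000 * s := by linarith
  have hg : P.gain = t + P.μ * t := by unfold gain; ring
  have hg1 : s ≤ P.gain := by nlinarith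
  have hμt : P.μ * t ≤ 1 / 10000000 * t := mul_le_mul_of_nonneg_right (by linarith) (by linarith)
  have hg2 : P.gain ≤ 1001 / 1000 * s := by linarith
  have hg3 : P.gain ≤ 1 / 1000000 := by linarith
  have htg : t ≤ P.gain := by nlinarith
  have hg0 : 0 < P.gain := by linarith
  have hθ1 : 1 ≤ P.thetaG := by linarith
  set B := (2 * P.thetaG ^ 2 + 5 * P.thetaG - 5) / (2 * (P.thetaG + 1)) with hB
  have hB1 : 1 / 2 ≤ B := by
    rw [hB, le_div_iff₀ (by linarith)]; nlinarith
  have hB2 : B ≤ 1 / 2 + 3 * t := by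
    rw [hB, div_le_iff₀ (by linarith), htdef]; nlinarith
  -- This is α = 999/1000 solved for gain·c₁. As B is close to 1/2, gain·c₁ is close to 0.499.
  have hgc : P.gain * P.c₁ = 999 / 1000 * (1 - P.gain) - B - P.gain := by
    have : P.c₁ = (999 / 1000 * (1 - P.gain) - B) / P.gain - 1 := by rw [hc₁]; rfl
    rw [this]; field_simp
  have hγ : P.coefGamma (1 + P.φ) P.thetaG = P.gain := by
    unfold coefGamma gain zetaMax
    rw [div_self (by linarith : P.thetaG ≠ 0)]
    field_simp
  refine ⟨hρ, hμ0, hg1, hg2, hg3, hθ1, ?_, by linarith, by linarith, hd, hU, ?_, ?_⟩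
  · have : (1 + P.μ) * P.thetaG = 1 + P.gain + P.μ := by unfold gain; ring
    linarith
  · unfold coefAlpha
    rw [hγ]
    have h1 : 0 < 1 - P.gain := by linarith
    have h2 : (2 * P.thetaG ^ 2 + 5 * P.thetaG - 5) / (2 * (P.thetaG + 1) * (1 - P.gain))
        = B / (1 - P.gain) := by rw [hB, div_div]
    rw [h2, div_mul_eq_mul_div, ← add_div, div_eq_iff h1.ne', mul_add, hgc]
    ring
  · unfold coefBeta
    rw [hγ]
    have h1 : 0 < 1 - P.gain := by linarith
    have h2 : P.gain ≤ P.gain / (1 - P.gain) := by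
      rw [le_div_iff₀ h1]; nlinarith
    have h3 : 1 ≤ 1 / (1 - P.gain) := by
      rw [le_div_iff₀ h1]; linarith
    have h4 : 2 ≤ 3 * P.thetaG - 1 + P.gain * P.c₁ := by linarith
    have h5 : 1 * 2 ≤ 1 / (1 - P.gain) * (3 * P.thetaG - 1 + P.gain * P.c₁) := by gcongr
    rw [one_mul] at h5
    exact add_le_add (mul_le_mul_of_nonneg_right h2 hd.le) (mul_le_mul_of_nonneg_right h5 hU)

/-- The limit of the error bounds. -/
def errLim (P : SyncParams) : ℝ := 1000 * P.coefBeta (1 + P.φ) P.thetaG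

namespace Tuned

variable {P : SyncParams} (hP : P.Tuned)
include hP

theorem gain_pos : 0 < P.gain := by
  linarith [hP.drift_le_gain, hP.rho_pos, hP.rho_le_mu]

/-- The factor 1000 = 1/(1 - α) is what makes U and gain·d negligible against the limit error; hence
a contraction rate so close to 1. -/
theorem le_errLim : 1000 * (P.gain * P.d) + 2000 * P.U ≤ P.errLim := by
  unfold errLim; linarith [hP.le_beta]

theorem errLim_pos : 0 < P.errLim := by
  have := mul_pos hP.gain_pos hP.d_pos
  linarith [hP.le_errLim, hP.U_nonneg]

theorem err_add_sub (a b : ℕ) :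
    P.err (a + b) - P.errLim = (999 / 1000) ^ b * (P.err a - P.errLim) := by
  induction b with
  | zero => simp
  | succ b ih =>
    rw [pow_succ', mul_assoc, ← ih]
    change P.coefAlpha (1 + P.φ) P.thetaG * P.err (a + b) + P.coefBeta (1 + P.φ) P.thetaG - _ = _
    rw [hP.alpha_eq]
    unfold errLim
    ring

theorem tendsto_err : Tendsto P.err atTop (𝓝 P.errLim) := by
  have h : P.err = fun b => (999 / 1000) ^ b * (P.err 0 - P.errLim) + P.errLim := by
    ext b
    have := hP.err_add_sub 0 b
    rw [zero_add] at this
    linarith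
  rw [h]
  simpa using ((tendsto_pow_atTop_nhds_zero_of_lt_one (r := (999 / 1000 : ℝ)) (by norm_num)
    (by norm_num)).mul_const (P.err 0 - P.errLim)).add_const P.errLim

theorem err_nonneg (h0 : 0 ≤ P.e₀) (r : ℕ) : 0 ≤ P.err r := by
  induction r with
  | zero => exact h0
  | succ r ih =>
    change 0 ≤ P.coefAlpha (1 + P.φ) P.thetaG * P.err r + P.coefBeta (1 + P.φ) P.thetaG
    have := hP.errLim_pos
    unfold errLim at this
    rw [hP.alpha_eq]
    linarith

theorem abs_err_sub_le {N : ℕ} (hN : (999 / 1000 : ℝ) ^ N ≤ 1 / 1000) {a j : ℕ}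
    (h0 : 0 ≤ P.err a) (h2 : P.err a ≤ 2 * P.errLim) (hj : a + N ≤ j) :
    |P.err j - P.errLim| ≤ P.errLim / 1000 := by
  obtain ⟨b, rfl⟩ := Nat.exists_eq_add_of_le hj
  rw [add_assoc, hP.err_add_sub, abs_mul, abs_of_nonneg (by positivity), pow_add]
  have h3 : |P.err a - P.errLim| ≤ P.errLim := by rw [abs_le]; constructor <;> linarith
  have h4 : (999 / 1000 : ℝ) ^ b ≤ 1 := pow_le_one₀ (by norm_num) (by norm_num)
  calc (999 / 1000 : ℝ) ^ N * (999 / 1000) ^ b * |P.err a - P.errLim|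
      ≤ 1 / 1000 * 1 * P.errLim := by gcongr
    _ = _ := by ring

/-- The crude skew bound of a proper execution. -/
theorem skew_le {e : ℝ} (he : e ≤ 1001 / 1000 * P.errLim) :
    (1 + P.μ) * P.thetaG * (2 * e + P.d) - P.d + P.U ≤ 3 * P.errLim := by
  have h1 := hP.le_errLim
  have h2 := hP.mul_thetaG_le
  have h3 := hP.gain_small
  have hd := hP.d_pos
  have hU := hP.U_nonneg
  have hL := hP.errLim_pos
  have hμ : 0 ≤ P.μ := by linarith [hP.rho_le_mu, hP.rho_pos]
  have h0 : 0 ≤ (1 + P.μ) * P.thetaG :=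
    mul_nonneg (by linarith) (by linarith [hP.one_le_thetaG])
  calc (1 + P.μ) * P.thetaG * (2 * e + P.d) - P.d + P.U
      ≤ (1 + P.μ) * P.thetaG * (2 * (1001 / 1000 * P.errLim) + P.d) - P.d + P.U := by gcongr
    _ ≤ (1 + 2 * P.gain) * (2 * (1001 / 1000 * P.errLim) + P.d) - P.d + P.U := by gcongr
    -- The delay d cancels up to 2·gain·d, which is at most errLim/500.
    _ ≤ _ := by nlinarith [mul_le_mul_of_nonneg_right h3 hL.le]

theorem rho_mul_le {y : ℝ} (hy : 0 ≤ y) : 33 * (P.ρ * y) ≤ P.gain * y := by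
  have : 33 * P.ρ ≤ P.gain := by linarith [hP.drift_le_gain, hP.rho_le_mu]
  nlinarith

/-- The round length is of the order of `errLim / gain`. -/
theorem gain_mul_length_le {e₁ e₂ : ℝ} (he₁0 : 0 ≤ e₁) (he₂0 : 0 ≤ e₂)
    (he₁ : e₁ ≤ 1001 / 1000 * P.errLim) (he₂ : e₂ ≤ 1001 / 1000 * P.errLim) :
    P.gain * ((1 + P.μ) * P.thetaG * (e₁ + P.d + P.c₁ * (e₁ + P.U) + e₂))
      ≤ 51 / 100 * P.errLim := by
  have h1 := hP.le_errLim
  have h3 := hP.gain_small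
  have hg := hP.gain_pos
  have hd := hP.d_pos
  have hU := hP.U_nonneg
  have hL := hP.errLim_pos
  have hgd : 0 < P.gain * P.d := mul_pos hg hd
  have c1 : P.gain * P.c₁ * (e₁ + P.U) ≤ 1 / 2 * (1001 / 1000 * P.errLim + P.errLim / 2000) :=
    mul_le_mul hP.gain_mul_c₁_le (by linarith) (by linarith) (by norm_num)
  have c2 : P.gain * (e₁ + e₂) ≤ 1 / 1000000 * (3 * P.errLim) :=
    mul_le_mul h3 (by linarith) (by linarith) (by norm_num)
  calc P.gain * ((1 + P.μ) * P.thetaG * (e₁ + P.d + P.c₁ * (e₁ + P.U) + e₂))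
      = (1 + P.μ) * P.thetaG * (P.gain * (e₁ + e₂) + P.gain * P.d + P.gain * P.c₁ * (e₁ + P.U)) := by
        ring
    _ ≤ (1 + 2 / 1000000) * (1 / 1000000 * (3 * P.errLim) + P.errLim / 1000
          + 1 / 2 * (1001 / 1000 * P.errLim + P.errLim / 2000)) := by
        refine mul_le_mul (by linarith [hP.mul_thetaG_le]) (by linarith) ?_ (by norm_num)
        have := mul_nonneg (show 0 ≤ P.gain * P.c₁ by linarith [hP.le_gain_mul_c₁])
          (show 0 ≤ e₁ + P.U by linarith)
        have := mul_nonneg hg.le (show 0 ≤ e₁ + e₂ by linarith)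
        linarith
    _ ≤ _ := by linarith

theorem rho_le : P.ρ ≤ 1 / 33000000 := by
  linarith [hP.drift_le_gain, hP.rho_le_mu, hP.gain_small]

/-- One step of the skew recursion in a unanimous cluster. -/
theorem skew_step_le {E e₁ e₂ : ℝ} (hE0 : 0 ≤ E) (hE : E ≤ 4 * P.errLim) (he₁0 : 0 ≤ e₁)
    (he₂0 : 0 ≤ e₂) (he₁ : e₁ ≤ 1001 / 1000 * P.errLim) (he₂ : e₂ ≤ 1001 / 1000 * P.errLim) :
    E / 2 + 2 * P.U + 2 * P.ρ * (E + P.U) + P.ρ * ((1 + P.ρ) * (E + P.U)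
        + (1 + P.μ) * P.thetaG * (e₁ + P.d + P.c₁ * (e₁ + P.U) + e₂))
      ≤ E / 2 + 17 / 1000 * P.errLim := by
  have h1 := hP.le_errLim
  have hg := hP.gain_pos
  have hd := hP.d_pos
  have hU := hP.U_nonneg
  have hL := hP.errLim_pos
  have hρ := hP.rho_pos
  have hρ' := hP.rho_le
  have hgd : 0 < P.gain * P.d := mul_pos hg hd
  have c1 := hP.gain_mul_length_le he₁0 he₂0 he₁ he₂
  have hμ : 0 ≤ P.μ := by linarith [hP.rho_le_mu, hP.rho_pos]
  have hθ := hP.one_le_thetaG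
  have hc : 0 ≤ P.c₁ := by
    by_contra! hc
    nlinarith [hP.le_gain_mul_c₁]
  -- Drift over the round costs at most 51/3300 ≈ 0.0155 of errLim and 2U at most 0.001; the
  -- remaining terms are negligible.
  have c2 := hP.rho_mul_le
    (show 0 ≤ (1 + P.μ) * P.thetaG * (e₁ + P.d + P.c₁ * (e₁ + P.U) + e₂) by positivity)
  have c3 : P.ρ * (E + P.U) ≤ 1 / 33000000 * (5 * P.errLim) :=
    mul_le_mul hρ' (by linarith) (by linarith) (by norm_num)
  have c4 : P.ρ * (P.ρ * (E + P.U)) ≤ 1 * (1 / 33000000 * (5 * P.errLim)) :=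
    mul_le_mul (by linarith) c3 (by positivity) (by norm_num)
  linarith

/-- The deviations of the clock advance in a round are small compared with the speed-up `μ`. -/
theorem deviation_le {E e₁ T D Y S : ℝ} (hE0 : 0 ≤ E) (hE : E ≤ 35 / 1000 * P.errLim)
    (he₁ : 999 / 1000 * P.errLim ≤ e₁) (he₁' : e₁ ≤ 1001 / 1000 * P.errLim)
    (hT₁ : P.c₁ * (e₁ + P.U) ≤ T)
    (hT₂ : T ≤ (1 + P.μ) * P.thetaG * (e₁ + P.d + P.c₁ * (e₁ + P.U) + e₁))
    (hD : T - (1 + P.ρ) * (E + P.U) ≤ (1 + P.ρ) * D)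
    (hS : S = 2 * (E + P.ρ * ((1 + P.μ) * P.thetaG * e₁))
      + 2 * ((1 + P.ρ) * (E + P.U)) + P.ρ * T)
    (hY : Y = (1 + P.ρ) * (E + P.U)
      + (P.ρ + 2 * (9 * P.gain) + 2 * (9 * P.gain) * P.ρ) * S) :
    0 < D ∧ (1 + P.ρ) * (E + P.U) ≤ Y ∧ (1 + P.μ) * (Y + P.ρ * T) ≤ P.μ / 8 * D := by
  have h1 := hP.le_errLim
  have hg := hP.gain_pos
  have hg' := hP.gain_small
  have hd := hP.d_pos
  have hU := hP.U_nonneg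
  have hL := hP.errLim_pos
  have hρ := hP.rho_pos
  have hρ' := hP.rho_le
  have hgd : 0 < P.gain * P.d := mul_pos hg hd
  have hμρ := hP.rho_le_mu
  have hμ : 0 < P.μ := by linarith
  have hμg : P.μ ≤ P.gain := by linarith [hP.drift_le_gain]
  have hθ := hP.one_le_thetaG
  have hc : 0 ≤ P.c₁ := by
    by_contra! hc
    nlinarith [hP.le_gain_mul_c₁]
  have he0 : 0 ≤ e₁ := by linarith
  have hT0 : 0 ≤ T := le_trans (by positivity) hT₁
  set L := P.errLim
  have gT : P.gain * T ≤ 51 / 100 * L :=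
    (mul_le_mul_of_nonneg_left hT₂ hg.le).trans (hP.gain_mul_length_le he0 he0 he₁' he₁')
  have gT' : 497 / 1000 * L ≤ P.gain * T := by
    calc 497 / 1000 * L ≤ 498 / 1000 * (999 / 1000 * L) := by linarith
      _ ≤ P.gain * P.c₁ * (e₁ + P.U) :=
        mul_le_mul hP.le_gain_mul_c₁ (by linarith) (by positivity) (by positivity)
      _ = P.gain * (P.c₁ * (e₁ + P.U)) := by ring
      _ ≤ _ := mul_le_mul_of_nonneg_left hT₁ hg.le
  have rT := hP.rho_mul_le hT0
  have rT0 : 0 ≤ P.ρ * T := by positivity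
  have eU : (1 + P.ρ) * (E + P.U) ≤ 356 / 10000 * L := by
    calc (1 + P.ρ) * (E + P.U) ≤ (1 + 1 / 33000000) * (355 / 10000 * L) := by
          refine mul_le_mul (by linarith) (by linarith) (by positivity) (by norm_num)
      _ ≤ _ := by linarith
  have eU0 : 0 ≤ (1 + P.ρ) * (E + P.U) := by positivity
  have τe : (1 + P.μ) * P.thetaG * e₁ ≤ 2 * (2 * L) :=
    mul_le_mul (by linarith [hP.mul_thetaG_le]) (by linarith) he0 (by norm_num)
  have ρτ : P.ρ * ((1 + P.μ) * P.thetaG * e₁) ≤ 1 / 33000000 * (2 * (2 * L)) :=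
    mul_le_mul hρ' τe (by positivity) (by norm_num)
  have ρτ0 : 0 ≤ P.ρ * ((1 + P.μ) * P.thetaG * e₁) := by positivity
  have hS' : S ≤ L := by rw [hS]; linarith
  have hS0 : 0 ≤ S := by rw [hS]; linarith
  have gρ : P.gain * P.ρ ≤ P.gain * 1 := mul_le_mul_of_nonneg_left (by linarith) hg.le
  have hy : P.ρ + 2 * (9 * P.gain) + 2 * (9 * P.gain) * P.ρ ≤ 37 / 1000000 := by linarith
  have hy0 : 0 ≤ P.ρ + 2 * (9 * P.gain) + 2 * (9 * P.gain) * P.ρ := by positivity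
  have yS : (P.ρ + 2 * (9 * P.gain) + 2 * (9 * P.gain) * P.ρ) * S ≤ 37 / 1000000 * L :=
    mul_le_mul hy hS' hS0 (by norm_num)
  have yS0 := mul_nonneg hy0 hS0
  have hY' : Y ≤ 357 / 10000 * L := by rw [hY]; linarith
  have hY0 : 0 ≤ Y := by rw [hY]; linarith
  have bigT : 4970 * L ≤ T := by
    have := mul_le_mul_of_nonneg_right hg' hT0
    linarith
  have hD0 : 0 < D := by
    refine pos_of_mul_pos_right (a := 1 + P.ρ) ?_ (by linarith)
    linarith
  refine ⟨hD0, by rw [hY]; linarith, ?_⟩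
  have hD' : T - P.ρ * T - 356 / 10000 * L ≤ D := by
    have h2 : (T - 356 / 10000 * L) ≤ (1 + P.ρ) * D := by linarith
    have h3 : (T - 356 / 10000 * L) * (1 - P.ρ) ≤ D := by
      have := mul_le_mul_of_nonneg_right h2 (show 0 ≤ 1 - P.ρ by linarith)
      have : 0 ≤ D * P.ρ ^ 2 := by positivity
      nlinarith
    have : 0 ≤ L * P.ρ := by positivity
    linarith
  have hμD := mul_le_mul_of_nonneg_left hD' hμ.le
  have μρT : P.μ * (P.ρ * T) ≤ 1 / 1000000 * (1 / 33 * (51 / 100 * L)) :=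
    mul_le_mul (by linarith) (by linarith) rT0 (by norm_num)
  have μL : P.μ * L ≤ 1 / 1000000 * L := mul_le_mul_of_nonneg_right (by linarith) hL.le
  have μY : P.μ * Y ≤ 1 / 1000000 * L := by
    have : P.μ * Y ≤ P.μ * L := mul_le_mul_of_nonneg_left (by linarith) hμ.le
    linarith
  -- From μ ≥ 32ρ follows μ/8 - ρ ≥ (ρ + μ)/11, and ρ + μ ≥ (1000/1001)·gain. Times T this is at
  -- least about 0.045·errLim, against Y ≤ 0.0357·errLim.
  have key : 1000 / 11011 * P.gain ≤ P.μ / 8 - P.ρ := by linarith [hP.gain_le_drift]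
  have keyT := mul_le_mul_of_nonneg_right key hT0
  linarith

end Tuned
end SyncParams

/-! ### Average rates and the main theorem -/

/-- Maximum and minimum each move by an amount in [lo, hi], even if they are attained at different
indices before and after. -/
theorem midrange_sub_bounds {ι : Type*} [Finite ι] [Nonempty ι] {g₁ g₂ : ι → ℝ} {lo hi : ℝ}
    (hg : ∀ w, lo ≤ g₂ w - g₁ w ∧ g₂ w - g₁ w ≤ hi) :
    lo ≤ ((⨆ w, g₂ w) + ⨅ w, g₂ w) / 2 - ((⨆ w, g₁ w) + ⨅ w, g₁ w) / 2 ∧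
      ((⨆ w, g₂ w) + ⨅ w, g₂ w) / 2 - ((⨆ w, g₁ w) + ⨅ w, g₁ w) / 2 ≤ hi := by
  have a (g : ι → ℝ) (w) : g w ≤ ⨆ w, g w := le_ciSup (Set.finite_range g).bddAbove w
  have b (g : ι → ℝ) (w) : ⨅ w, g w ≤ g w := ciInf_le (Set.finite_range g).bddBelow w
  have s1 : (⨆ w, g₁ w) ≤ (⨆ w, g₂ w) - lo := ciSup_le fun w => by linarith [a g₂ w, hg w]
  have s2 : (⨆ w, g₂ w) ≤ (⨆ w, g₁ w) + hi := ciSup_le fun w => by linarith [a g₁ w, hg w]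
  have i1 : (⨅ w, g₁ w) + lo ≤ ⨅ w, g₂ w := le_ciInf fun w => by linarith [b g₁ w, hg w]
  have i2 : (⨅ w, g₂ w) - hi ≤ ⨅ w, g₁ w := le_ciInf fun w => by linarith [b g₂ w, hg w]
  constructor <;> linarith

namespace SyncParams

theorem Valid.le_tau3 {P : SyncParams} (hP : P.Valid) {c : ℝ} (hc : c = 0 ∨ c = 1) (j : ℕ) :
    P.nominalRate c * (P.c₁ * (P.err j + P.U)) ≤ P.tau3 j := by
  have h1 : 0 ≤ P.c₁ * (P.err j + P.U) :=
    mul_nonneg (by linarith [hP.one_lt_c₁]) (by linarith [hP.err_nonneg j, hP.U_nonneg])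
  have h2 : P.nominalRate c ≤ P.zetaMax * P.thetaG :=
    (hP.nominalRate_le_zetaMax hc).trans
      (le_mul_of_one_le_right hP.zetaMax_pos.le hP.one_le_thetaG)
  calc _ ≤ P.zetaMax * P.thetaG * (P.c₁ * (P.err j + P.U)) := mul_le_mul_of_nonneg_right h2 h1
    _ = _ := by unfold tau3; ring

end SyncParams

namespace ClusterTrace

variable {n : ℕ} {X : ClusterTrace n} {P : SyncParams} {f : ℕ} {F : Finset (Fin n)}

/-- From bounds on the advance in a round to bounds on the average rate. -/
theorem abs_avgRate_sub_le {Λ : ℝ → ℝ} {v : Fin n} {r : ℕ} {c Y : ℝ} (hφ : 0 < P.φ)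
    (hμ : 0 ≤ P.μ) (hc : c = 0 ∨ c = 1) (hY : 0 ≤ Y) (hD : 0 < X.t v (r + 1) - X.t v r)
    (hΛ : |Λ (X.t v (r + 1)) - Λ (X.t v r) - P.nominalRate c * (X.t v (r + 1) - X.t v r)|
      ≤ P.nominalRate c * Y)
    (hdev : (1 + P.μ) * Y ≤ P.μ / 8 * (X.t v (r + 1) - X.t v r)) :
    |X.avgRate Λ v r - P.nominalRate c| ≤ (1 + P.φ) * (P.μ / 8) := by
  have e : X.avgRate Λ v r - P.nominalRate c
      = (Λ (X.t v (r + 1)) - Λ (X.t v r) - P.nominalRate c * (X.t v (r + 1) - X.t v r))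
        / (X.t v (r + 1) - X.t v r) := by
    unfold avgRate; field_simp
  rw [e, abs_div, abs_of_pos hD, div_le_iff₀ hD]
  refine hΛ.trans ?_
  have h1 : P.nominalRate c ≤ (1 + P.φ) * (1 + P.μ) := by
    unfold SyncParams.nominalRate
    rcases hc with rfl | rfl <;> nlinarith
  calc P.nominalRate c * Y ≤ (1 + P.φ) * (1 + P.μ) * Y := mul_le_mul_of_nonneg_right h1 hY
    _ = (1 + P.φ) * ((1 + P.μ) * Y) := by ring
    _ ≤ (1 + P.φ) * (P.μ / 8 * (X.t v (r + 1) - X.t v r)) :=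
      mul_le_mul_of_nonneg_left hdev (by linarith)
    _ = _ := by ring

namespace IsProperExecution

theorem avgRate_bounds (h : X.IsProperExecution P f F) (hP : P.Tuned) (hn : 3 * f + 1 ≤ n)
    (hF : F.card ≤ f) {c : ℝ} (hc : c = 0 ∨ c = 1) {r₀ : ℕ}
    (herr : ∀ j, r₀ ≤ j → |P.err j - P.errLim| ≤ P.errLim / 1000)
    (hu : ∀ j, r₀ ≤ j → j ≤ r₀ + 12 → X.UnanimousRound F c j) :
    (∀ v ∉ F, |X.avgRate (X.L P v) v (r₀ + 12) - P.nominalRate c| ≤ (1 + P.φ) * (P.μ / 8)) ∧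
      (X.UnanimousRound F c (r₀ + 13) → ∀ v ∉ F,
        |X.avgRate (X.clusterClock P F) v (r₀ + 12) - P.nominalRate c|
          ≤ (1 + P.φ) * (P.μ / 8)) := by
  have hL := hP.errLim_pos
  have hU := h.valid.U_nonneg
  have hφ := h.valid.phi_pos
  have hμ := h.valid.mu_nonneg
  have hρ := h.valid.rho_pos
  have hz := h.valid.nominalRate_pos hc
  have c1 := h.valid.one_lt_c₁
  have hUL : P.U ≤ P.errLim / 2000 := by
    linarith [hP.le_errLim, mul_pos hP.gain_pos hP.d_pos]
  have lo : ∀ j, r₀ ≤ j → 999 / 1000 * P.errLim ≤ P.err j := fun j hj => by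
    linarith [(abs_le.1 (herr j hj)).1]
  have up : ∀ j, r₀ ≤ j → P.err j ≤ 1001 / 1000 * P.errLim := fun j hj => by
    linarith [(abs_le.1 (herr j hj)).2]
  have hτ : ∀ j, r₀ ≤ j → 0 < P.tau3 j := fun j hj => by
    refine lt_of_lt_of_le ?_ (h.valid.le_tau3 hc j)
    have : 0 < P.err j + P.U := by linarith [lo j hj]
    positivity
  have crude : ∀ j, r₀ ≤ j → X.PulseSkewLE F j (3 * P.errLim) := fun j hj v hv w hw =>
    (h.pulse_skew_le hv hw j).trans (hP.skew_le (up j hj))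
  -- The map E ↦ E/2 + 17/1000·errLim has fixed point 34/1000·errLim, and 3/2¹² < 1/1000.
  have chain : ∀ i ≤ 12,
      X.PulseSkewLE F (r₀ + i) (3 * P.errLim / 2 ^ i + 34 / 1000 * P.errLim) := by
    intro i
    induction i with
    | zero =>
      intro _ v hv w hw
      rw [pow_zero, div_one]
      exact (crude r₀ le_rfl v hv w hw).trans (by linarith)
    | succ i ih =>
      intro hi v hv w hw
      have h0 : 0 ≤ 3 * P.errLim / 2 ^ i := by positivity
      have h1 : 3 * P.errLim / 2 ^ i ≤ 3 * P.errLim :=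
        div_le_self (by positivity) (one_le_pow₀ (by norm_num))
      refine (h.pulse_skew_step hc (hu (r₀ + i) (by omega) (by omega)) hn hF
        (hu (r₀ + i + 1) (by omega) (by omega)) (hτ _ (by omega)) (ih (by omega)) v hv w hw).trans ?_
      refine (hP.skew_step_le (by linarith) (by linarith) (h.valid.err_nonneg _)
        (h.valid.err_nonneg _) (up _ (by omega)) (up _ (by omega))).trans (le_of_eq ?_)
      rw [pow_succ]
      field_simp
      ring
  -- The round in question becomes i + 1, so that its predecessor i is available for comparing
  -- clocks at its start.
  obtain ⟨i, hi⟩ : ∃ i, i + 1 = r₀ + 12 := ⟨r₀ + 11, rfl⟩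
  have hi2 : r₀ + 13 = i + 2 := by omega
  have hE : X.PulseSkewLE F (i + 1) (35 / 1000 * P.errLim) := by
    rw [hi]
    exact fun v hv w hw => (chain 12 le_rfl v hv w hw).trans (by norm_num; linarith)
  rw [← hi, hi2]
  set e := P.err (i + 1) with he
  set E := 35 / 1000 * P.errLim with hEdef
  have hE0 : 0 ≤ E := by positivity
  obtain ⟨T, hT⟩ : ∃ T, P.roundLength (i + 1) = P.nominalRate c * T :=
    ⟨P.roundLength (i + 1) / P.nominalRate c, by field_simp⟩
  have e0 : 0 ≤ e := h.valid.err_nonneg _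
  have hT₁ : P.c₁ * (e + P.U) ≤ T := by
    refine le_of_mul_le_mul_left ((h.valid.le_tau3 hc (i + 1)).trans ?_) hz
    rw [← hT]
    unfold SyncParams.roundLength
    linarith [h.valid.tau1_nonneg (i + 1), h.valid.tau2_pos (i + 1)]
  have hT₂ : T ≤ (1 + P.μ) * P.thetaG * (e + P.d + P.c₁ * (e + P.U) + e) := by
    have := h.valid.d_pos
    refine le_of_mul_le_mul_left (le_of_eq_of_le ?_
      (h.valid.zetaMax_mul_thetaG_mul_le hc (by positivity))) hz
    rw [← hT, he]
    unfold SyncParams.roundLength SyncParams.tau1 SyncParams.tau2 SyncParams.tau3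
    ring
  have hT0 : 0 ≤ T := le_trans (by positivity) hT₁
  obtain ⟨S, hS⟩ : ∃ S, S = 2 * (E + P.ρ * ((1 + P.μ) * P.thetaG * e))
      + 2 * ((1 + P.ρ) * (E + P.U)) + P.ρ * T := ⟨_, rfl⟩
  obtain ⟨Y, hY⟩ : ∃ Y, Y = (1 + P.ρ) * (E + P.U)
      + (P.ρ + 2 * (9 * P.gain) + 2 * (9 * P.gain) * P.ρ) * S := ⟨_, rfl⟩
  have hu1 : X.UnanimousRound F c (i + 1) := hu _ (by omega) (by omega)
  have own := fun v (hv : v ∉ F) =>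
    h.advance_own_round hc hn hF hu1 (hτ _ (by omega)) hE hT hv
  have dev := fun v (hv : v ∉ F) => hP.deviation_le hE0 le_rfl (lo (i + 1) (by omega))
    (up (i + 1) (by omega)) hT₁ hT₂ (own v hv).2.2 hS hY
  have hY0 : ∀ v ∉ F, 0 ≤ Y + P.ρ * T := fun v hv => by
    have : 0 ≤ (1 + P.ρ) * (E + P.U) := by positivity
    have : 0 ≤ P.ρ * T := by positivity
    linarith [(dev v hv).2.1]
  refine ⟨fun v hv => ?_, fun hu2 v hv => ?_⟩
  · obtain ⟨d1, d2, d3⟩ := dev v hv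
    obtain ⟨o1, o2, o3⟩ := own v hv
    refine abs_avgRate_sub_le hφ hμ hc (hY0 v hv) d1 ?_ d3
    rw [o1, ← mul_sub, abs_mul, abs_of_pos hz]
    refine mul_le_mul_of_nonneg_left ?_ hz.le
    have hδ : 0 ≤ (1 + P.ρ) * (E + P.U) := by positivity
    rw [abs_le]
    constructor
    · have : 0 ≤ P.ρ * T := by positivity
      linarith
    -- With D the real length and δ = (1 + ρ)(E + U), T - D ≤ δ + ρD ≤ δ + ρT + ρδ; the last term is
    -- absorbed by the S-term of Y.
    · have : P.ρ * (X.t v (i + 1 + 1) - X.t v (i + 1)) ≤ P.ρ * (T + (1 + P.ρ) * (E + P.U)) :=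
        mul_le_mul_of_nonneg_left o2 hρ.le
      have hS1 : (1 + P.ρ) * (E + P.U) ≤ S := by
        have : 0 ≤ P.ρ * ((1 + P.μ) * P.thetaG * e) := by
          have := h.valid.one_le_thetaG
          positivity
        have : 0 ≤ P.ρ * T := by positivity
        linarith
      have hg := hP.gain_pos
      have : P.ρ * ((1 + P.ρ) * (E + P.U))
          ≤ (P.ρ + 2 * (9 * P.gain) + 2 * (9 * P.gain) * P.ρ) * S := by
        refine mul_le_mul ?_ hS1 hδ (by positivity)
        have : 0 ≤ 2 * (9 * P.gain) * P.ρ := by positivity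
        linarith
      linarith
  · obtain ⟨d1, d2, d3⟩ := dev v hv
    refine abs_avgRate_sub_le hφ hμ hc (hY0 v hv) d1 ?_ d3
    have hg := hP.gain_pos
    -- The crude skew suffices here: Δ ≲ 3.001·ζ·errLim, while gain·τ₃ ≳ 0.497·ζ·errLim, so the
    -- factor 9 leaves room.
    have hx : ∀ j, i ≤ j → j ≤ i + 2 → X.UnanimousRound F c j → ∀ w ∉ F,
        |X.corr P f w j| ≤ 9 * P.gain * P.tau3 j := by
      intro j hj1 hj2 huj w hw
      refine (h.abs_corr_le hc hw huj hn hF (crude j (by omega))).trans ?_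
      refine le_trans ?_ (mul_le_mul_of_nonneg_left (h.valid.le_tau3 hc j)
        (show 0 ≤ 9 * P.gain by linarith))
      have l := lo j (by omega)
      have a1 : (1 + P.ρ) * (3 * P.errLim + P.U) ≤ (1 + 1 / 33000000) * (3001 / 1000 * P.errLim) :=
        mul_le_mul (by linarith [hP.rho_le]) (by linarith) (by positivity) (by norm_num)
      have a2 : 498 / 1000 * (999 / 1000 * P.errLim) ≤ P.gain * P.c₁ * (P.err j + P.U) :=
        mul_le_mul hP.le_gain_mul_c₁ (by linarith) (by positivity) (by positivity)
      calc P.nominalRate c * ((1 + P.ρ) * (3 * P.errLim + P.U))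
          ≤ P.nominalRate c * (9 * (P.gain * P.c₁ * (P.err j + P.U))) :=
            mul_le_mul_of_nonneg_left (by linarith) hz.le
        _ = _ := by ring
    have huni : ∀ j, i ≤ j → j ≤ i + 2 → X.UnanimousRound F c j := by
      intro j hj1 hj2
      rcases Nat.lt_or_ge j (i + 2) with hj3 | hj3
      · exact hu j (by omega) (by omega)
      · rwa [show j = i + 2 by omega]
    have : Nonempty {w : Fin n // w ∉ F} := ⟨⟨v, hv⟩⟩
    have := midrange_sub_bounds (g₁ := fun w : {w : Fin n // w ∉ F} => X.L P w (X.t v (i + 1)))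
      (g₂ := fun w : {w : Fin n // w ∉ F} => X.L P w (X.t v (i + 2))) fun w =>
      h.advance_other_round hc hn hF huni (show 0 ≤ 9 * P.gain by linarith)
        (by linarith [hP.gain_small]) (fun j hj _ => hτ j (by omega))
        (fun j hj1 hj2 => hx j hj1 hj2 (huni j hj1 hj2)) hE0 hE hT hS hY hv w.2
    have hρT : 0 ≤ P.nominalRate c * (P.ρ * T) := by positivity
    rw [abs_le]
    unfold clusterClock
    simp only [show i + 1 + 1 = i + 2 from rfl]
    constructor <;> linarith [this.1, this.2]

end IsProperExecution
end ClusterTrace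

theorem mainTheorem2 (c₂ : ℝ) (hc₂ : 32 ≤ c₂) :
    ∃ (k : ℕ) (a b ρ₀ : ℝ), 0 < a ∧ 0 < b ∧ 0 < ρ₀ ∧
      ∀ ρ : ℝ, 0 < ρ → ρ < ρ₀ →
        ∃ c₁ : ℝ, a / ρ ≤ c₁ ∧ c₁ ≤ b / ρ ∧ 1 < c₁ ∧
          ∀ P : SyncParams, P.ρ = ρ → P.μ = c₂ * ρ → P.c₁ = c₁ →
            1 / c₁ ≤ P.φ → P.φ < 1 →
            0 ≤ P.U → P.U ≤ P.d → 0 < P.d → 0 ≤ P.e₀ →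
            ∃ eInf : ℝ, Tendsto P.err atTop (𝓝 eInf) ∧
              ∀ (n f : ℕ) (F : Finset (Fin n)), 3 * f + 1 ≤ n → F.card ≤ f →
                ∀ X : ClusterTrace n, X.IsExecution P f F →
                  (∀ j, X.ProperRound P f F j) →
                  ∀ r : ℕ, k ≤ r → P.err (r - k) ≤ 2 * eInf →
                    ((∀ j, r - k ≤ j → j ≤ r → X.FastRound F j) →
                      (∀ v ∉ F,
                        (1 + P.φ) * (1 + 7 / 8 * P.μ) ≤ X.avgRate (X.L P v) v r) ∧
                      (X.FastRound F (r + 1) → ∀ v ∉ F,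
                        (1 + P.φ) * (1 + 7 / 8 * P.μ) ≤
                          X.avgRate (X.clusterClock P F) v r)) ∧
                    ((∀ j, r - k ≤ j → j ≤ r → X.SlowRound F j) →
                      (∀ v ∉ F,
                        (1 + P.φ) * (1 - 1 / 8 * P.μ) ≤ X.avgRate (X.L P v) v r ∧
                        X.avgRate (X.L P v) v r ≤ (1 + P.φ) * (1 + 1 / 8 * P.μ)) ∧
                      (X.SlowRound F (r + 1) → ∀ v ∉ F,
                        (1 + P.φ) * (1 - 1 / 8 * P.μ) ≤
                            X.avgRate (X.clusterClock P F) v r ∧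
                          X.avgRate (X.clusterClock P F) v r ≤
                            (1 + P.φ) * (1 + 1 / 8 * P.μ))) := by
  obtain ⟨N, hN⟩ := exists_pow_lt_of_lt_one (show (0 : ℝ) < 1 / 1000 by norm_num)
    (show (999 / 1000 : ℝ) < 1 by norm_num)
  have hc : 0 < 1 + c₂ := by linarith
  -- N rounds bring e within errLim/1000 of its limit, and 12 more shrink the skew. The constants a,
  -- b reflect gain·c₁ ≈ 1/2 with gain ≈ (1 + c₂)ρ.
  refine ⟨N + 12, 2 / 5 / (1 + c₂), 1 / 2 / (1 + c₂), 1 / 10000000 / (1 + c₂), by positivity,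
    by positivity, by positivity, fun ρ hρ hρ₀ => ?_⟩
  rw [lt_div_iff₀ hc] at hρ₀
  have tuned : ∀ P : SyncParams, P.ρ = ρ → P.μ = c₂ * ρ →
      P.c₁ = SyncParams.stretch ρ (c₂ * ρ) → 0 < 1 + P.φ → 0 < P.d → 0 ≤ P.U → P.Tuned :=
    fun P h1 h2 h3 h4 h5 h6 => SyncParams.tuned_of_stretch hc₂ (by rwa [h1]) (by rw [h1]; exact hρ₀.le)
      (by rw [h1, h2]) (by rw [h1, h2, h3]) h4 h5 h6
  -- The bounds on c₁ must precede the choice of `P`. They involve only ρ and μ, so any φ, d, U, e₀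
  -- admitted by `tuned` will do.
  have hP₀ := tuned ⟨ρ, c₂ * ρ, 1, SyncParams.stretch ρ (c₂ * ρ), 1, 0, 0⟩ rfl rfl rfl
    (by norm_num) one_pos le_rfl
  set c₁ := SyncParams.stretch ρ (c₂ * ρ) with hc₁
  set P₀ : SyncParams := ⟨ρ, c₂ * ρ, 1, c₁, 1, 0, 0⟩ with hP₀def
  have g0 := hP₀.gain_pos
  have g1 : ρ + c₂ * ρ ≤ P₀.gain := hP₀.drift_le_gain
  have g2 : P₀.gain ≤ 1001 / 1000 * (ρ + c₂ * ρ) := hP₀.gain_le_drift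
  have g3 := hP₀.gain_small
  have g4 : 498 / 1000 ≤ P₀.gain * c₁ := hP₀.le_gain_mul_c₁
  have g5 : P₀.gain * c₁ ≤ 1 / 2 := hP₀.gain_mul_c₁_le
  have c1 : 1 < c₁ := by
    by_contra! hle
    have := mul_le_mul_of_nonneg_left hle g0.le
    linarith
  refine ⟨c₁, ?_, ?_, c1, ?_⟩
  · rw [div_div, div_le_iff₀ (by positivity)]
    have := mul_le_mul_of_nonneg_right g2 (show 0 ≤ c₁ by linarith)
    linarith
  · rw [div_div, le_div_iff₀ (by positivity)]
    have := mul_le_mul_of_nonneg_right g1 (show 0 ≤ c₁ by linarith)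
    linarith
  intro P h1 h2 h3 hφ hφ1 hU hUd hd he₀
  have hφ0 : 0 < P.φ := lt_of_lt_of_le (by positivity) hφ
  have hP : P.Tuned := tuned P h1 h2 h3 (by linarith) hd hU
  refine ⟨P.errLim, hP.tendsto_err, fun n f F hn hF X hX hproper r hr herr => ?_⟩
  have hV : P.Valid := ⟨hP.rho_pos, by linarith [hP.rho_pos, hP.rho_le_mu], hφ0, hφ1,
    by rw [h3]; exact c1, hd, hU, hUd, hP.err_nonneg he₀⟩
  obtain ⟨r₀, rfl⟩ : ∃ r₀, r = r₀ + 12 := ⟨r - 12, by omega⟩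
  have key := fun {c : ℝ} (hc : c = 0 ∨ c = 1) =>
    ClusterTrace.IsProperExecution.avgRate_bounds (X := X) ⟨hV, hX, hproper⟩ hP hn hF hc
      (r₀ := r₀) fun j hj =>
        hP.abs_err_sub_le hN.le (hP.err_nonneg he₀ _) herr (by omega)
  constructor
  · intro hu
    obtain ⟨k1, k2⟩ := key (Or.inr rfl) fun j hj1 hj2 => hu j (by omega) hj2
    unfold SyncParams.nominalRate at k1 k2
    exact ⟨fun v hv => by linarith [(abs_le.1 (k1 v hv)).1],
      fun hu' v hv => by linarith [(abs_le.1 (k2 hu' v hv)).1]⟩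
  · intro hu
    obtain ⟨k1, k2⟩ := key (Or.inl rfl) fun j hj1 hj2 => hu j (by omega) hj2
    unfold SyncParams.nominalRate at k1 k2
    exact ⟨fun v hv => by
        constructor <;> linarith [(abs_le.1 (k1 v hv)).1, (abs_le.1 (k1 v hv)).2],
      fun hu' v hv => by
        constructor <;> linarith [(abs_le.1 (k2 hu' v hv)).1, (abs_le.1 (k2 hu' v hv)).2]⟩

end
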